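/- **Theorem 1.2.** Let $M\in GL(2,\mathbb Z)$ be hyperbolic (no eigenvalue of modulus $1$) with trace $r>0$ and determinant $\sigma=\pm1$, let $T$ be the automorphism of $\mathbb T^2=\mathbb R^2/\mathbb Z^2$ given by $M$, and let $\lambda=\frac12\bigl(r+\sqrt{r^2-4\sigma}\bigr)>1$. A point $t\in\mathbb T^2$ is *homoclinic* if $T^nt\to 0$ as $n\to\pm\infty$. Let $\widetilde{\mathfrak X}$ be the additive semigroup of all sequences $\varepsilon=(\varepsilon_n)_{n\in\mathbb Z}$ of nonnegative integers for which $\sum_{n\ge1}\varepsilon_n\lambda^{-n}$ and $\sum_{n\ge1}\varepsilon_{-n}\lambda^{-n}$ converge, with the weakest topology that makes all coordinates and both of these sums continuous, and let $(\tau\varepsilon)_n=\varepsilon_{n+1}$. A sequence is *finite* if it has only finitely many nonzero coordinates. An *arithmetic coding* of $T$ is a pair $(\varphi,\mathfrak X)$ such that * $\varphi:\widetilde{\mathfrak X}\to\mathbb T^2$ is a continuous semigroup homomorphism with $\varphi\tau=T\varphi$; * $\mathfrak X\subset\widetilde{\mathfrak X}$ is closed, satisfies $\tau\mathfrak X=\mathfrak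 X$, and is *total*: if $\varepsilon\in\mathfrak X$, $N\in\mathbb Z$, and $\varepsilon'\in\widetilde{\mathfrak X}$ is such that for every $k\in\mathbb Z$ the sequence $(\varepsilon'_{N+k},\varepsilon'_{N+k+1},\dots)$ is lexicographically less than or equal to $(\varepsilon_N,\varepsilon_{N+1},\dots)$, then $\varepsilon'\in\mathfrak X$; * $\varphi(\mathfrak X)=\mathbb T^2$, and $\varphi$ is injective on the set of finite sequences in $\mathfrak X$. Let $\mathfrak X_r$ be the Markov compactum of all $(\varepsilon_n)_{n\in\mathbb Z}$ with $\varepsilon_n\in\{0,\dots,r\}$ such that $\varepsilon_n=r$ implies $\varepsilon_{n+1}=0$, and let $\mathfrak Y_r$ be the sofic compactum of all $(\varepsilon_n)_{n\in\mathbb Z}$ with $\varepsilon_n\in\{0,\dots,r-1\}$ that contain no block $(r-1)(r-2)^s(r-1)$, $s\ge0$. **(I)** For each homoclinic point $t$ there is exactly one $w\in\mathbb R^2$ with $Mw=\lambda w$ and $w\equiv t \bmod\mathbb Z^2$ (the coordinates of $t$ in $\mathbb R^2$), and for each $\varepsilon\in\widetilde{\mathfrak X}$ the two-sided series in $$\varphi_t(\varepsilon)=\sum_{n=-\infty}^{\infty}\varepsilon_nT^{-n}t=\Bigl(\sum_{n=-\infty}^{\infty}\varepsilon_n\lambda^{-n}\Bigr)w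 \bmod\mathbb Z^2$$ converge in $\mathbb T^2$ (the partial sums over $-k\le n\le l$ converge as $k,l\to\infty$) to the same point. The map $t\mapsto\varphi_t$ is a bijection from the set of homoclinic points onto the set of continuous semigroup homomorphisms $\varphi:\widetilde{\mathfrak X}\to\mathbb T^2$ with $\varphi\tau=T\varphi$. If $t\ne0$, then $\varphi_t$ is surjective. Moreover, $t\mapsto(\varphi_t,\mathfrak X)$, where $\mathfrak X=\mathfrak X_r$ if $\sigma=-1$ and $\mathfrak X=\mathfrak Y_r$ if $\sigma=+1$, is a bijection from the set of nonzero homoclinic points onto the set of arithmetic codings of $T$. **(II)** If $(\varphi,\mathfrak X)$ is an arithmetic coding of $T$, then $\mathfrak X=\mathfrak X_r$ when $\sigma=-1$, and $\mathfrak X=\mathfrak Y_r$ when $\sigma=+1$. -/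

import Mathlib

open Filter Topology

noncomputable section

namespace ToralCoding

/-- The 2-torus `ℝ² / ℤ²`. -/
abbrev Torus : Type := UnitAddTorus (Fin 2)

/-- The projection `ℝ² → ℝ² / ℤ²`, that is, reduction modulo `ℤ²`. -/
def proj (w : Fin 2 → ℝ) : Torus := fun i => (w i : UnitAddCircle)

/-- The automorphism `T` of the torus given by the matrix `M ∈ GL(2, ℤ)`. -/
def toralAut (M : GL (Fin 2) ℤ) (x : Torus) : Torus := fun i => ∑ j, M.val i j • x j

/-- `T` acts on the torus as `M` acts on `ℝ²`. -/
theorem toralAut_proj (M : GL (Fin 2) ℤ) (w : Fin 2 → ℝ) :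
    toralAut M (proj w) = proj ((M.val.map (Int.cast : ℤ → ℝ)).mulVec w) := by
  funext i
  simp only [toralAut, proj, Matrix.mulVec, dotProduct, Matrix.map_apply, Fin.sum_univ_two,
    AddCircle.coe_add, ← zsmul_eq_mul, AddCircle.coe_zsmul]

theorem toralAut_one (x : Torus) : toralAut 1 x = x := by
  funext i
  fin_cases i <;> simp [toralAut]

/-- `toralAut (M ^ n)` is the `n`-th iterate (`n ∈ ℤ`) of `toralAut M`, because of this
and the preceding identity. -/
theorem toralAut_mul (M N : GL (Fin 2) ℤ) (x : Torus) :
    toralAut (M * N) x = toralAut M (toralAut N x) := by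
  funext i
  simp only [toralAut, Units.val_mul, Matrix.mul_apply, Fin.sum_univ_two, add_smul, mul_smul,
    smul_add]
  abel

/-- The trace `r` of `M`. -/
def tr (M : GL (Fin 2) ℤ) : ℤ := M.val.trace

/-- The determinant `σ` of `M`. -/
def dt (M : GL (Fin 2) ℤ) : ℤ := M.val.det

/-- Hyperbolicity: no eigenvalue of `M` lies on the unit circle. -/
def IsHyperbolic (M : GL (Fin 2) ℤ) : Prop :=
  ∀ z ∈ spectrum ℂ (M.val.map (Int.cast : ℤ → ℂ)), ‖z‖ ≠ 1

/-- The eigenvalue `(r + √(r² - 4σ)) / 2` of `M`; for hyperbolic `M` of positive trace it is the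
one that is greater than `1`. -/
def lam (M : GL (Fin 2) ℤ) : ℝ :=
  ((tr M : ℝ) + Real.sqrt ((tr M : ℝ) ^ 2 - 4 * (dt M : ℝ))) / 2

/-- A point of the torus is homoclinic to zero if `T ^ n t → 0` as `n → +∞` and as `n → -∞`. -/
def IsHomoclinic (M : GL (Fin 2) ℤ) (t : Torus) : Prop :=
  Tendsto (fun n : ℤ => toralAut (M ^ n) t) atTop (𝓝 0) ∧
    Tendsto (fun n : ℤ => toralAut (M ^ n) t) atBot (𝓝 0)

/-- The additive semigroup of the two-sided sequences of nonnegative integers such that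
`∑_{n ≥ 1} ε_n λ^{-n}` and `∑_{n ≥ 1} ε_{-n} λ^{-n}` converge. -/
def primarySubmonoid (M : GL (Fin 2) ℤ) : AddSubmonoid (ℤ → ℕ) where
  carrier := {e | Summable (fun n : ℕ => (e (n + 1) : ℝ) * ((lam M)⁻¹) ^ (n + 1)) ∧
    Summable (fun n : ℕ => (e (-(n + 1)) : ℝ) * ((lam M)⁻¹) ^ (n + 1))}
  zero_mem' := by simp [summable_zero]
  add_mem' := by
    rintro a b ⟨ha, ha'⟩ ⟨hb, hb'⟩
    refine ⟨(ha.add hb).congr fun n => ?_, (ha'.add hb').congr fun n => ?_⟩ <;>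
      simp [add_mul]

/-- The primary symbolic set, as a type of its own, so that it does not inherit the product
topology of `ℤ → ℕ`. -/
def PrimarySpace (M : GL (Fin 2) ℤ) : Type := primarySubmonoid M

variable {M : GL (Fin 2) ℤ}

instance : AddCommMonoid (PrimarySpace M) :=
  inferInstanceAs (AddCommMonoid (primarySubmonoid M))

/-- The sequence underlying a point of the primary symbolic set. -/
def PrimarySpace.seq (e : PrimarySpace M) : ℤ → ℕ := Subtype.val e

theorem PrimarySpace.seq_add (e e' : PrimarySpace M) : (e + e').seq = e.seq + e'.seq := rfl

/-- The sum `∑_{n ≥ 1} ε_n λ^{-n}`. -/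
def PrimarySpace.sumPos (e : PrimarySpace M) : ℝ :=
  ∑' n : ℕ, (e.seq (n + 1) : ℝ) * ((lam M)⁻¹) ^ (n + 1)

/-- The sum `∑_{n ≥ 1} ε_{-n} λ^{-n}`. -/
def PrimarySpace.sumNeg (e : PrimarySpace M) : ℝ :=
  ∑' n : ℕ, (e.seq (-(n + 1)) : ℝ) * ((lam M)⁻¹) ^ (n + 1)

/-- The natural weak topology of the primary symbolic set: the weakest one for which all the
coordinates and the sums of the two series are continuous. (For nonnegative sequences it is also
the topology of the weighted norm `∑ |ε_n| λ^{-|n|}`; on sequences with bounded digits it is the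
product topology.) -/
instance : TopologicalSpace (PrimarySpace M) :=
  TopologicalSpace.induced
    (fun e : PrimarySpace M => ((e.seq, e.sumPos, e.sumNeg) : (ℤ → ℕ) × ℝ × ℝ)) inferInstance

theorem shift_mem {e : ℤ → ℕ} (he : e ∈ primarySubmonoid M) :
    (fun n => e (n + 1)) ∈ primarySubmonoid M := by
  obtain ⟨h1, h2⟩ := he
  by_cases h0 : lam M = 0
  · constructor <;> simp [h0, summable_zero]
  refine ⟨?_, ?_⟩
  · refine (((summable_nat_add_iff 1).2 h1).mul_left (lam M)).congr fun n => ?_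
    push_cast
    rw [pow_succ _ (n + 1)]
    field_simp
  · rw [← summable_nat_add_iff 1]
    refine (h2.mul_left ((lam M)⁻¹)).congr fun n => ?_
    dsimp only
    rw [show (-(((n + 1 : ℕ) : ℤ) + 1) + 1 : ℤ) = -((n : ℤ) + 1) by push_cast; ring]
    ring

/-- The two-sided shift `τ`, `(τ ε)_n = ε_{n+1}`. -/
def shift (e : PrimarySpace M) : PrimarySpace M :=
  ⟨fun n => e.seq (n + 1), shift_mem (Subtype.property e)⟩

theorem shift_seq (e : PrimarySpace M) (n : ℤ) : (shift e).seq n = e.seq (n + 1) := rfl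

/-- Finite sequences: only finitely many coordinates are nonzero. -/
def finiteSeqs (M : GL (Fin 2) ℤ) : Set (PrimarySpace M) :=
  {e | (Function.support e.seq).Finite}

/-- The one-sided sequence `(ε_n, ε_{n+1}, …)`. -/
def tail (e : ℤ → ℕ) (n : ℤ) : ℕ → ℕ := fun k => e (n + k)

/-- `a` is lexicographically less than or equal to `b`. -/
def LexLE (a b : ℕ → ℕ) : Prop :=
  a = b ∨ ∃ n, (∀ m < n, a m = b m) ∧ a n < b n

/-- `X` is total: together with `ε` it contains each `ε'` all of whose tails are lexicographically
at most one fixed tail `(ε_N, ε_{N+1}, …)` of `ε`. -/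
def IsTotal (X : Set (PrimarySpace M)) : Prop :=
  ∀ e ∈ X, ∀ e' : PrimarySpace M,
    (∃ N : ℤ, ∀ k : ℤ, LexLE (tail e'.seq (N + k)) (tail e.seq N)) → e' ∈ X

/-- Continuous semigroup homomorphisms from the primary symbolic set to the torus that turn the
shift into `T`. -/
structure IsEquivariantHom (φ : PrimarySpace M → Torus) : Prop where
  continuous : Continuous φ
  map_add : ∀ e e', φ (e + e') = φ e + φ e'
  map_shift : ∀ e, φ (shift e) = toralAut M (φ e)

/-- Arithmetic codings `(φ, X)` of `T`. -/
structure IsArithmeticCoding (φ : PrimarySpace M → Torus) (X : Set (PrimarySpace M)) : Prop where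
  hom : IsEquivariantHom φ
  closed : IsClosed X
  shift_invariant : shift '' X = X
  total : IsTotal X
  surjective : φ '' X = Set.univ
  injective_on_finite : Set.InjOn φ (X ∩ finiteSeqs M)

/-- `φ_t(ε) = lim_{N → ∞} ∑_{n = -N}^{N} ε_n T^{-n} t`. -/
def codingMap (M : GL (Fin 2) ℤ) (t : Torus) (e : PrimarySpace M) : Torus :=
  limUnder atTop (fun N : ℕ =>
    ∑ n ∈ Finset.Icc (-(N : ℤ)) (N : ℤ), e.seq n • toralAut (M ^ (-n)) t)

/-- The coordinates in `ℝ²` of a homoclinic point `t`: the vector `w` of the expanding eigenline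
of `M` that represents `t` modulo `ℤ²`. -/
def IsPlanarCoordinates (M : GL (Fin 2) ℤ) (t : Torus) (w : Fin 2 → ℝ) : Prop :=
  (M.val.map (Int.cast : ℤ → ℝ)).mulVec w = lam M • w ∧ proj w = t

/-- The Markov compactum `X_r`: digits `0, …, r`, and a digit `r` is followed by `0`. -/
def markovCompactum (r : ℤ) : Set (ℤ → ℕ) :=
  {e | ∀ n, (e n : ℤ) ≤ r ∧ ((e n : ℤ) = r → e (n + 1) = 0)}

/-- The sofic compactum `Y_r`: digits `0, …, r - 1`, and no block
`(r-1)(r-2)^s(r-1)` with `s ≥ 0`. -/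
def soficCompactum (r : ℤ) : Set (ℤ → ℕ) :=
  {e | ∀ n, (e n : ℤ) ≤ r - 1 ∧
    ∀ s : ℕ, ¬ ((e n : ℤ) = r - 1 ∧ (∀ j : ℕ, 1 ≤ j → j ≤ s → (e (n + j) : ℤ) = r - 2) ∧
      (e (n + s + 1) : ℤ) = r - 1)}

/-- The symbolic compactum of `T`: `X_r` if `det M = -1` and `Y_r` otherwise. -/
def compactum (M : GL (Fin 2) ℤ) : Set (ℤ → ℕ) :=
  if dt M = -1 then markovCompactum (tr M) else soficCompactum (tr M)

end ToralCoding

end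

/-!
A homoclinic point has coordinates `w` on the expanding eigenline and `s` on the contracting one, so
`φ_t` is `(∑_{n ≥ 0} ε_n λ^{-n}) w + (∑_{n ≥ 1} ε_{-n} μ^n) s` modulo `ℤ²`, where `μ` is the other
eigenvalue. An equivariant homomorphism is determined by its value at the unit sequence at `0`,
because finite sequences are dense, and this value is homoclinic.

Let `a` be the quasi-greedy `λ`-expansion of `1`. The compactum consists of the sequences all of
whose tails are lexicographically at most `a`. Every `x ≥ 0` has a greedy expansion in base `λ`
among these sequences, so the closed image of the compactum contains the points `x w`, which are
dense in the torus; uniqueness of finite expansions gives injectivity.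

Conversely let `(φ, X)` be any coding. By the Cayley–Hamilton theorem the words `r1`, respectively
`(r-1)(r-2)^k(r-1)`, have the same image as other finite sequences whose tails are all
lexicographically smaller; by totality a sequence of `X` exceeding such a word would put both codes
into `X`. Hence `X` lies in the compactum. If no sequence of `X` contained the first `m` digits of
`a`, then the numbers coded by `X` would form a null set, countably many translates of which cannot
cover the line. Hence `X` contains arbitrarily long prefixes of `a`, and by totality and closedness
it is the whole compactum.
-/

namespace ToralCoding

open MeasureTheory Pointwise PrimarySpace

section Lexicographic

variable {a b : ℕ → ℕ}

theorem lexLE_iff_toLex_le : LexLE a b ↔ toLex a ≤ toLex b :=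
  (le_iff_eq_or_lt (a := toLex a) (b := toLex b)).symm

theorem lexLE_iff : LexLE a b ↔ ∀ j, (∀ i < j, a i = b i) → a j ≤ b j := by
  rw [lexLE_iff_toLex_le, ← not_lt]
  refine ⟨fun h j hj => ?_, ?_⟩
  · by_contra! hlt
    exact h ⟨j, fun i hi => (hj i hi).symm, hlt⟩
  · rintro h ⟨j, hj, hlt⟩
    exact (h j fun i hi => (hj i hi).symm).not_gt hlt

theorem LexLE.trans {c : ℕ → ℕ} (h : LexLE a b) (h' : LexLE b c) : LexLE a c :=
  lexLE_iff_toLex_le.2 ((lexLE_iff_toLex_le.1 h).trans (lexLE_iff_toLex_le.1 h'))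

theorem LexLE.zero_le (h : LexLE a b) : a 0 ≤ b 0 := lexLE_iff.1 h 0 (by simp)

theorem LexLE.exists_lt {J : ℕ} (h : LexLE a b) (hJ : a J ≠ b J) :
    ∃ j ≤ J, (∀ i < j, a i = b i) ∧ a j < b j := by
  obtain rfl | ⟨j, hj, hlt⟩ := h
  · exact absurd rfl hJ
  · exact ⟨j, not_lt.1 fun hlt => hJ (hj J hlt), hj, hlt⟩

end Lexicographic

/-- The two-sided sequences all of whose tails are lexicographically at most `a`: Parry's
admissibility condition when `a` is the quasi-greedy expansion of `1`. -/
def Admissible (a : ℕ → ℕ) (e : ℤ → ℕ) : Prop := ∀ n, LexLE (tail e n) a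

theorem Admissible.le_zero {a : ℕ → ℕ} {e : ℤ → ℕ} (h : Admissible a e) (n : ℤ) : e n ≤ a 0 := by
  simpa [tail] using (h n).zero_le

/-- The value `∑ b_k β^{-k-1}` of a one-sided digit sequence in base `β`. -/
noncomputable def digitSum (β : ℝ) (b : ℕ → ℕ) : ℝ := ∑' k, (b k : ℝ) * β⁻¹ ^ (k + 1)

section DigitSum

variable {β : ℝ} {a b : ℕ → ℕ} {e : ℤ → ℕ}

theorem summable_digits (hβ : 1 < β) {C : ℕ} (hb : ∀ k, b k ≤ C) :
    Summable (fun k => (b k : ℝ) * β⁻¹ ^ (k + 1)) := by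
  have h0 : 0 ≤ β⁻¹ := by positivity
  have hgeom : Summable (fun k : ℕ => (C : ℝ) * β⁻¹ ^ (k + 1)) :=
    ((summable_nat_add_iff 1).2
      (summable_geometric_of_lt_one h0 (inv_lt_one_of_one_lt₀ hβ))).mul_left _
  refine hgeom.of_nonneg_of_le (fun k => by positivity) fun k => ?_
  have : (b k : ℝ) ≤ C := mod_cast hb k
  gcongr

theorem digitSum_nonneg (hβ : 0 ≤ β) : 0 ≤ digitSum β b := tsum_nonneg fun k => by positivity

theorem digitSum_tail_eq (hβ : 1 < β) {C : ℕ} (he : ∀ n, e n ≤ C) {n : ℤ} {j : ℕ}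
    (h : ∀ i < j, tail e n i = b i) :
    digitSum β (tail e n) = ∑ i ∈ Finset.range j, (b i : ℝ) * β⁻¹ ^ (i + 1) +
      (tail e n j + digitSum β (tail e (n + j + 1))) * β⁻¹ ^ (j + 1) := by
  have hsum : Summable (fun k => (tail e n k : ℝ) * β⁻¹ ^ (k + 1)) :=
    summable_digits hβ fun k => he _
  have htail : ∀ k : ℕ, (tail e n (k + (j + 1)) : ℝ) * β⁻¹ ^ (k + (j + 1) + 1) =
      (tail e (n + j + 1) k : ℝ) * β⁻¹ ^ (k + 1) * β⁻¹ ^ (j + 1) := fun k => by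
    rw [mul_assoc, ← pow_add, tail, tail,
      show n + ((k + (j + 1) : ℕ) : ℤ) = n + j + 1 + k by push_cast; ring]
    congr 2
    ring
  rw [digitSum, ← hsum.sum_add_tsum_nat_add (j + 1), tsum_congr htail, tsum_mul_right,
    Finset.sum_range_succ, Finset.sum_congr rfl fun i hi => by rw [h i (Finset.mem_range.1 hi)],
    digitSum]
  ring

theorem hasSum_tail_iff (hβ : 0 < β) {N : ℤ} (he : ∀ n < N, e n = 0) {s : ℝ} :
    HasSum (fun k => (tail e N k : ℝ) * β⁻¹ ^ (k + 1)) s ↔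
      HasSum (fun n : ℤ => (e n : ℝ) * β ^ (-n)) (β ^ (1 - N) * s) := by
  have hinj : Function.Injective (fun k : ℕ => N + k) := fun i j h => by simpa using h
  have hrange : ∀ n ∉ Set.range (fun k : ℕ => N + (k : ℤ)), (e n : ℝ) * β ^ (-n) = 0 := by
    intro n hn
    have : n < N := by
      by_contra! hle
      exact hn ⟨(n - N).toNat, by grind⟩
    simp [he n this]
  rw [← hinj.hasSum_iff hrange, ← hasSum_mul_left_iff (zpow_ne_zero (1 - N) hβ.ne')]
  refine iff_of_eq (congrArg (HasSum · _) (funext fun k => ?_))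
  have : β ^ (-(N + k)) = β ^ (1 - N) * β⁻¹ ^ (k + 1) := by
    rw [inv_pow, ← zpow_natCast, ← zpow_neg, ← zpow_add₀ hβ.ne']
    congr 1
    push_cast
    ring
  simp only [Function.comp_apply, this, tail]
  ring

theorem eq_sum_add_remainder (hβ : β ≠ 0) {y : ℕ → ℝ} (h : ∀ k, β * y k = b k + y (k + 1))
    (m : ℕ) : y 0 = ∑ i ∈ Finset.range m, (b i : ℝ) * β⁻¹ ^ (i + 1) + y m * β⁻¹ ^ m := by
  induction m with
  | zero => simp
  | succ m ih =>
    have : y m = β⁻¹ * (b m + y (m + 1)) := by rw [← h, inv_mul_cancel_left₀ hβ]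
    rw [ih, Finset.sum_range_succ, this]
    ring

theorem hasSum_of_remainders (hβ : 1 < β) {y : ℕ → ℝ} (h : ∀ k, β * y k = b k + y (k + 1))
    (h0 : ∀ k, 0 ≤ y k) (h1 : ∀ k, y k ≤ 1) :
    HasSum (fun k => (b k : ℝ) * β⁻¹ ^ (k + 1)) (y 0) := by
  have hpos : 0 < β := zero_lt_one.trans hβ
  rw [hasSum_iff_tendsto_nat_of_nonneg fun k => by positivity]
  have hrem : Tendsto (fun m => y m * β⁻¹ ^ m) atTop (𝓝 0) :=
    squeeze_zero (fun m => mul_nonneg (h0 m) (by positivity))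
      (fun m => mul_le_of_le_one_left (by positivity) (h1 m))
      (tendsto_pow_atTop_nhds_zero_of_lt_one (inv_nonneg.2 hpos.le) (inv_lt_one_of_one_lt₀ hβ))
  have hlim : Tendsto (fun m => y 0 - y m * β⁻¹ ^ m) atTop (𝓝 (y 0)) := by
    simpa using tendsto_const_nhds.sub hrem
  refine hlim.congr fun m => ?_
  linarith [eq_sum_add_remainder hpos.ne' h m]

end DigitSum

/-- `a` is a quasi-greedy expansion of `1` in base `β`: every finite section of `a` has a value
below `1`, but its value reaches `1` when the last digit is increased by one. -/
structure IsQuasiGreedy (β : ℝ) (a : ℕ → ℕ) : Prop where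
  one_lt : 1 < β
  sum_lt_one : ∀ m, ∑ i ∈ Finset.range m, (a i : ℝ) * β⁻¹ ^ (i + 1) < 1
  one_le_sum_add : ∀ m, 1 ≤ ∑ i ∈ Finset.range m, (a i : ℝ) * β⁻¹ ^ (i + 1) + β⁻¹ ^ m

namespace IsQuasiGreedy

variable {β : ℝ} {a : ℕ → ℕ} {e e' : ℤ → ℕ} {x : ℝ}

theorem of_remainders (hβ : 1 < β) {y : ℕ → ℝ} (h : ∀ k, β * y k = a k + y (k + 1))
    (hy : y 0 = 1) (h0 : ∀ k, 0 < y k) (h1 : ∀ k, y k ≤ 1) : IsQuasiGreedy β a := by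
  have hpos : 0 < β := zero_lt_one.trans hβ
  have hsum := eq_sum_add_remainder hpos.ne' h
  rw [hy] at hsum
  refine ⟨hβ, fun m => ?_, fun m => ?_⟩
  · have : 0 < y m * β⁻¹ ^ m := mul_pos (h0 m) (by positivity)
    linarith [hsum m]
  · have : y m * β⁻¹ ^ m ≤ β⁻¹ ^ m := mul_le_of_le_one_left (by positivity) (h1 m)
    linarith [hsum m]

theorem pos (ha : IsQuasiGreedy β a) : 0 < β := zero_lt_one.trans ha.one_lt

theorem exists_pos_of_le (ha : IsQuasiGreedy β a) (N : ℕ) : ∃ j, N ≤ j ∧ 0 < a j := by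
  by_contra! hzero
  have hconst : ∀ m ≥ N, ∑ i ∈ Finset.range m, (a i : ℝ) * β⁻¹ ^ (i + 1) =
      ∑ i ∈ Finset.range N, (a i : ℝ) * β⁻¹ ^ (i + 1) := fun m hm =>
    (Finset.sum_subset (Finset.range_subset_range.2 hm) fun i _ hi => by
      simp [Nat.le_zero.1 (hzero i (by simpa using hi))]).symm
  have hlim := (tendsto_pow_atTop_nhds_zero_of_lt_one (inv_nonneg.2 ha.pos.le)
    (inv_lt_one_of_one_lt₀ ha.one_lt)).const_add
      (∑ i ∈ Finset.range N, (a i : ℝ) * β⁻¹ ^ (i + 1))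
  have hle : 1 ≤ ∑ i ∈ Finset.range N, (a i : ℝ) * β⁻¹ ^ (i + 1) + 0 :=
    ge_of_tendsto hlim <| (eventually_ge_atTop N).mono fun m hm => by
      rw [← hconst m hm]
      exact ha.one_le_sum_add m
  linarith [ha.sum_lt_one N]

theorem zero_pos (ha : IsQuasiGreedy β a) : 0 < a 0 := by
  have h := ha.one_le_sum_add 1
  have : β⁻¹ < 1 := inv_lt_one_of_one_lt₀ ha.one_lt
  by_contra! h0
  simp [Nat.le_zero.1 h0] at h
  linarith

theorem digitSum_tail_lt_one (ha : IsQuasiGreedy β a) (he : Admissible a e) {L : ℤ}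
    (hL : ∀ n ≥ L, e n = 0) (n : ℤ) : digitSum β (tail e n) < 1 := by
  have hβ := ha.pos
  induction h : (L - n).toNat using Nat.strong_induction_on generalizing n with
  | _ k ih =>
    rcases le_or_gt L n with hn | hn
    · simp [digitSum, tail, fun i : ℕ => hL (n + i) (by omega)]
    obtain ⟨J, hJ, haJ⟩ := ha.exists_pos_of_le (L - n).toNat
    have hzero : tail e n J = 0 := hL _ (by omega)
    obtain ⟨j, -, hagree, hdrop⟩ := (he n).exists_lt (hzero.trans_ne haJ.ne)
    have hrest : digitSum β (tail e (n + j + 1)) < 1 := ih _ (by omega) _ rfl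
    have hdigit : (tail e n j : ℝ) + 1 ≤ a j := mod_cast hdrop
    calc digitSum β (tail e n)
        = ∑ i ∈ Finset.range j, (a i : ℝ) * β⁻¹ ^ (i + 1) +
          (tail e n j + digitSum β (tail e (n + j + 1))) * β⁻¹ ^ (j + 1) :=
        digitSum_tail_eq ha.one_lt he.le_zero hagree
      _ ≤ ∑ i ∈ Finset.range j, (a i : ℝ) * β⁻¹ ^ (i + 1) + a j * β⁻¹ ^ (j + 1) := by
        gcongr
        linarith
      _ < 1 := by simpa only [Finset.sum_range_succ] using ha.sum_lt_one (j + 1)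

theorem digitSum_tail_lt (ha : IsQuasiGreedy β a) (he : Admissible a e) {L : ℤ}
    (hL : ∀ n ≥ L, e n = 0) (he' : Admissible a e') {n : ℤ}
    (h : toLex (tail e n) < toLex (tail e' n)) :
    digitSum β (tail e n) < digitSum β (tail e' n) := by
  have hβ := ha.pos
  obtain ⟨j, hagree, hlt⟩ : ∃ j, (∀ i < j, tail e n i = tail e' n i) ∧ tail e n j < tail e' n j := h
  have hrest := ha.digitSum_tail_lt_one he hL (n + j + 1)
  have hrest' := digitSum_nonneg (b := tail e' (n + j + 1)) hβ.le
  have hdigit : (tail e n j : ℝ) + 1 ≤ tail e' n j := mod_cast hlt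
  rw [digitSum_tail_eq ha.one_lt he.le_zero hagree,
    digitSum_tail_eq (b := tail e' n) (j := j) ha.one_lt he'.le_zero fun _ _ => rfl]
  gcongr _ + ?_ * _
  linarith

theorem eq_of_hasSum (ha : IsQuasiGreedy β a) (he : Admissible a e) (he' : Admissible a e')
    (hfin : (Function.support e).Finite) (hfin' : (Function.support e').Finite)
    (hx : HasSum (fun n : ℤ => (e n : ℝ) * β ^ (-n)) x)
    (hx' : HasSum (fun n : ℤ => (e' n : ℝ) * β ^ (-n)) x) : e = e' := by
  obtain ⟨N, hN⟩ := (hfin.union hfin').bddBelow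
  obtain ⟨L, hL⟩ := (hfin.union hfin').bddAbove
  have hleft : ∀ n < N, e n = 0 ∧ e' n = 0 := fun n hn => by
    by_contra! h
    exact hn.not_ge (hN (by simp [Function.mem_support]; tauto))
  have hright : ∀ n ≥ L + 1, e n = 0 ∧ e' n = 0 := fun n hn => by
    by_contra! h
    have : n ≤ L := hL (by simp [Function.mem_support]; tauto)
    omega
  have hvalue : ∀ {d : ℤ → ℕ}, (∀ n < N, d n = 0) →
      HasSum (fun n : ℤ => (d n : ℝ) * β ^ (-n)) x →
        digitSum β (tail d N) = β ^ (N - 1) * x := fun hd h => by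
    refine ((hasSum_tail_iff ha.pos hd).2 ?_).tsum_eq
    rwa [← mul_assoc, ← zpow_add₀ ha.pos.ne', sub_add_sub_cancel', sub_self, zpow_zero, one_mul]
  have heq : digitSum β (tail e N) = digitSum β (tail e' N) :=
    (hvalue (fun n hn => (hleft n hn).1) hx).trans (hvalue (fun n hn => (hleft n hn).2) hx').symm
  have htail : tail e N = tail e' N := by
    rcases lt_trichotomy (toLex (tail e N)) (toLex (tail e' N)) with h | h | h
    · exact absurd heq (ha.digitSum_tail_lt he (fun n hn => (hright n hn).1) he' h).ne
    · exact h
    · exact absurd heq (ha.digitSum_tail_lt he' (fun n hn => (hright n hn).2) he h).ne'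
  funext n
  rcases lt_or_ge n N with hn | hn
  · rw [(hleft n hn).1, (hleft n hn).2]
  · have h := congrFun htail (n - N).toNat
    rwa [tail, tail, Int.toNat_of_nonneg (sub_nonneg.2 hn), add_sub_cancel] at h

end IsQuasiGreedy

section Greedy

variable {β x : ℝ} {a : ℕ → ℕ}

theorem exists_greedy_remainders (hβ : 1 < β) (hx : 0 ≤ x) :
    ∃ (N : ℤ) (y : ℤ → ℝ), (∀ n, 0 ≤ y n ∧ y n < 1) ∧
      (∀ n, y (n + 1) = Int.fract (β * y n)) ∧ ∀ n ≤ N, y n = β ^ (n - 1) * x := by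
  have hpos : 0 < β := zero_lt_one.trans hβ
  obtain ⟨k, hk⟩ := pow_unbounded_of_one_lt x hβ
  set N : ℤ := 1 - k
  have hsmall : ∀ n ≤ N, 0 ≤ β ^ (n - 1) * x ∧ β ^ (n - 1) * x < 1 := fun n hn => by
    refine ⟨by positivity, ?_⟩
    calc β ^ (n - 1) * x ≤ β ^ (-k : ℤ) * x := by gcongr; exacts [hβ.le, by omega]
      _ < β ^ (-k : ℤ) * β ^ (k : ℤ) := by rw [zpow_natCast]; gcongr
      _ = 1 := by rw [← zpow_add₀ hpos.ne', neg_add_cancel, zpow_zero]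
  set f : ℝ → ℝ := fun y => Int.fract (β * y)
  set y : ℤ → ℝ := fun n => f^[(n - N).toNat] (β ^ (min n N - 1) * x)
  have hleft : ∀ n ≤ N, y n = β ^ (n - 1) * x := fun n hn => by
    simp [y, min_eq_left hn, Int.toNat_of_nonpos (sub_nonpos.2 hn)]
  have hstep : ∀ n, y (n + 1) = f (y n) := fun n => by
    rcases lt_or_ge n N with hn | hn
    · have h : β * (β ^ (n - 1) * x) = β ^ (n + 1 - 1) * x := by
        rw [← mul_assoc, ← zpow_one_add₀ hpos.ne']
        congr 2
        ring
      rw [hleft n hn.le, hleft (n + 1) hn]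
      simp only [f]
      rw [h, Int.fract_eq_self.2 (hsmall (n + 1) hn)]
    · simp only [y]
      rw [min_eq_right hn, min_eq_right (by omega), ← Function.iterate_succ_apply' f]
      congr 1
      grind
  refine ⟨N, y, fun n => ?_, hstep, hleft⟩
  rcases le_or_gt n N with hn | -
  · rw [hleft n hn]
    exact hsmall n hn
  · rw [← sub_add_cancel n 1, hstep]
    exact ⟨Int.fract_nonneg _, Int.fract_lt_one _⟩

theorem IsQuasiGreedy.admissible_of_remainders (ha : IsQuasiGreedy β a) {y : ℤ → ℝ} {e : ℤ → ℕ}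
    (hy : ∀ n, 0 ≤ y n ∧ y n < 1) (h : ∀ n, β * y n = e n + y (n + 1)) : Admissible a e := by
  have hβ := ha.pos
  refine fun n => lexLE_iff.2 fun j hagree => not_lt.1 fun hlt => ?_
  have hsum := eq_sum_add_remainder hβ.ne' (y := fun k : ℕ => y (n + k)) (b := tail e n)
    (fun k => by simpa [tail, add_assoc] using h (n + k)) (j + 1)
  have hdigit : (a j : ℝ) + 1 ≤ tail e n j := mod_cast hlt
  have hrest : 0 ≤ y (n + (j + 1 : ℕ)) * β⁻¹ ^ (j + 1) := mul_nonneg (hy _).1 (by positivity)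
  have hge : 1 ≤ y n := calc
    1 ≤ ∑ i ∈ Finset.range j, (a i : ℝ) * β⁻¹ ^ (i + 1) + (a j + 1) * β⁻¹ ^ (j + 1) := by
      have := ha.one_le_sum_add (j + 1)
      rw [Finset.sum_range_succ] at this
      linarith
    _ ≤ ∑ i ∈ Finset.range j, (a i : ℝ) * β⁻¹ ^ (i + 1) + tail e n j * β⁻¹ ^ (j + 1) := by gcongr
    _ = ∑ i ∈ Finset.range (j + 1), (tail e n i : ℝ) * β⁻¹ ^ (i + 1) := by
      rw [Finset.sum_range_succ,
        Finset.sum_congr rfl fun i hi => by rw [← hagree i (Finset.mem_range.1 hi)]]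
    _ ≤ y n := by
      rw [Nat.cast_zero, add_zero] at hsum
      linarith
  exact hge.not_gt (hy n).2

theorem IsQuasiGreedy.exists_admissible_hasSum (ha : IsQuasiGreedy β a) (hx : 0 ≤ x) :
    ∃ e, Admissible a e ∧ HasSum (fun n : ℤ => (e n : ℝ) * β ^ (-n)) x := by
  have hβ := ha.pos
  obtain ⟨N, y, hy, hstep, hleft⟩ := exists_greedy_remainders ha.one_lt hx
  set e : ℤ → ℕ := fun n => ⌊β * y n⌋₊ with he
  have hdigit : ∀ n, β * y n = e n + y (n + 1) := fun n => by
    rw [hstep, he, natCast_floor_eq_intCast_floor (mul_nonneg hβ.le (hy n).1),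
      Int.floor_add_fract]
  have hzero : ∀ n < N, e n = 0 := fun n hn => by
    have h : β * y n = y (n + 1) := by
      rw [hleft n hn.le, hleft (n + 1) hn, ← mul_assoc, ← zpow_one_add₀ hβ.ne']
      congr 2
      ring
    exact Nat.floor_eq_zero.2 (h ▸ (hy (n + 1)).2)
  refine ⟨e, ha.admissible_of_remainders hy hdigit, ?_⟩
  have hsum : HasSum (fun k => (tail e N k : ℝ) * β⁻¹ ^ (k + 1)) (y (N + (0 : ℕ))) :=
    hasSum_of_remainders ha.one_lt (y := fun k : ℕ => y (N + k))
      (fun k => by simpa [tail, add_assoc] using hdigit (N + k)) (fun k => (hy _).1)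
      fun k => (hy _).2.le
  have hx : β ^ (1 - N) * y (N + (0 : ℕ)) = x := by
    rw [Nat.cast_zero, add_zero, hleft N le_rfl, ← mul_assoc, ← zpow_add₀ hβ.ne',
      sub_add_sub_cancel, sub_self, zpow_zero, one_mul]
  simpa only [hx] using (hasSum_tail_iff hβ hzero).1 hsum

end Greedy

section NullSet

variable {β : ℝ} {a : ℕ → ℕ} {m : ℕ}

/-- The two-sided sequences each of whose tails drops below `a` at one of its first `m` digits. -/
def dropsWithin (a : ℕ → ℕ) (m : ℕ) : Set (ℤ → ℕ) :=
  {e | ∀ n, ∃ j < m, (∀ i < j, tail e n i = a i) ∧ tail e n j < a j}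

theorem le_zero_of_mem_dropsWithin {e : ℤ → ℕ} (he : e ∈ dropsWithin a m) (n : ℤ) :
    e n ≤ a 0 := by
  obtain ⟨j, -, hagree, hlt⟩ := he n
  have hLE : LexLE (tail e n) a := Or.inr ⟨j, hagree, hlt⟩
  simpa [tail] using hLE.zero_le

theorem digitSum_tail_image_dropsWithin_subset (hβ : 1 < β) :
    (fun e => digitSum β (tail e 0)) '' dropsWithin a m ⊆
      ⋃ j ∈ Finset.range m, ⋃ d ∈ Finset.range (a j),
        (∑ i ∈ Finset.range j, (a i : ℝ) * β⁻¹ ^ (i + 1) + d * β⁻¹ ^ (j + 1)) +ᵥ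
          β⁻¹ ^ (j + 1) • (fun e => digitSum β (tail e 0)) '' dropsWithin a m := by
  rintro _ ⟨e, he, rfl⟩
  obtain ⟨j, hj, hagree, hlt⟩ := he 0
  have hshift : ∀ n, tail (fun k => e (k + (j + 1))) n = tail e (n + (j + 1)) := fun n => by
    funext k
    simp only [tail]
    congr 1
    ring
  simp only [Set.mem_iUnion, Finset.mem_range, Set.mem_vadd_set]
  refine ⟨j, hj, tail e 0 j, hlt, _, Set.smul_mem_smul_set
    ⟨fun k => e (k + (j + 1)), fun n => by rw [hshift]; exact he _, rfl⟩, ?_⟩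
  simp only
  rw [digitSum_tail_eq hβ (le_zero_of_mem_dropsWithin he) hagree, hshift, vadd_eq_add,
    smul_eq_mul, add_mul, ← add_assoc, ← add_assoc, mul_comm (β⁻¹ ^ (j + 1))]

theorem volume_digitSum_tail_image_dropsWithin_ne_top (hβ : 1 < β) :
    volume ((fun e => digitSum β (tail e 0)) '' dropsWithin a m) ≠ ⊤ := by
  suffices h : (fun e => digitSum β (tail e 0)) '' dropsWithin a m ⊆
      Set.Icc 0 (digitSum β fun _ => a 0) from measure_ne_top_of_subset h measure_Icc_lt_top.ne
  rintro _ ⟨e, he, rfl⟩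
  have hle : ∀ k, tail e 0 k ≤ a 0 := fun k => le_zero_of_mem_dropsWithin he _
  refine ⟨digitSum_nonneg (by positivity), ?_⟩
  refine (summable_digits hβ hle).tsum_le_tsum (fun k => ?_) (summable_digits hβ fun _ => le_rfl)
  have : (tail e 0 k : ℝ) ≤ a 0 := mod_cast hle k
  gcongr

-- The self-similar cover has total contraction ratio `∑_{i < m} a_i β^{-i-1} < 1`.
theorem IsQuasiGreedy.volume_digitSum_tail_image_dropsWithin (ha : IsQuasiGreedy β a) (m : ℕ) :
    volume ((fun e => digitSum β (tail e 0)) '' dropsWithin a m) = 0 := by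
  have hβ := ha.pos
  set E := (fun e => digitSum β (tail e 0)) '' dropsWithin a m
  have hfin : volume E ≠ ⊤ := volume_digitSum_tail_image_dropsWithin_ne_top ha.one_lt
  set ρ := ∑ i ∈ Finset.range m, (a i : ℝ) * β⁻¹ ^ (i + 1)
  have hle : volume E ≤ ENNReal.ofReal ρ * volume E := calc
    volume E ≤ ∑ j ∈ Finset.range m, ∑ _d ∈ Finset.range (a j),
        ENNReal.ofReal (β⁻¹ ^ (j + 1)) * volume E := by
      refine (measure_mono (digitSum_tail_image_dropsWithin_subset ha.one_lt)).trans <|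
        (measure_biUnion_finset_le _ _).trans <| Finset.sum_le_sum fun j _ =>
        (measure_biUnion_finset_le _ _).trans <| Finset.sum_le_sum fun d _ => ?_
      rw [measure_vadd, Measure.addHaar_smul, Module.finrank_self, pow_one,
        abs_of_pos (by positivity)]
    _ = ENNReal.ofReal ρ * volume E := by
      rw [ENNReal.ofReal_sum_of_nonneg fun i _ => by positivity, Finset.sum_mul]
      refine Finset.sum_congr rfl fun j _ => ?_
      rw [Finset.sum_const, Finset.card_range, nsmul_eq_mul, ENNReal.ofReal_mul (by positivity),
        ENNReal.ofReal_natCast, mul_assoc]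
  by_contra h0
  have hlt := ENNReal.mul_lt_mul_left h0 hfin (ENNReal.ofReal_lt_one.2 (ha.sum_lt_one m))
  rw [one_mul] at hlt
  exact hle.not_gt hlt

end NullSet

section Torus

variable {M : GL (Fin 2) ℤ}

theorem proj_zero : proj 0 = 0 := rfl

theorem proj_add (v w : Fin 2 → ℝ) : proj (v + w) = proj v + proj w := rfl

theorem proj_sub (v w : Fin 2 → ℝ) : proj (v - w) = proj v - proj w := rfl

theorem proj_nsmul (n : ℕ) (v : Fin 2 → ℝ) : proj (n • v) = n • proj v := rfl

theorem continuous_proj : Continuous proj :=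
  continuous_pi fun i => (AddCircle.continuous_mk' 1).comp (continuous_apply i)

theorem exists_int_of_proj_eq_zero {v : Fin 2 → ℝ} (h : proj v = 0) (i : Fin 2) :
    ∃ z : ℤ, (z : ℝ) = v i := by
  simpa using (AddCircle.coe_eq_zero_iff (1 : ℝ)).1 (congrFun h i)

theorem eq_zero_of_proj_eq_zero {v : Fin 2 → ℝ} (h : proj v = 0) (hv : ‖v‖ < 1) : v = 0 := by
  funext i
  obtain ⟨z, hz⟩ := exists_int_of_proj_eq_zero h i
  have hlt : |(z : ℝ)| < 1 := hz ▸ (norm_le_pi_norm v i).trans_lt hv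
  have hz0 : z = 0 := Int.abs_lt_one_iff.1 (mod_cast hlt)
  rw [← hz, hz0, Int.cast_zero, Pi.zero_apply]

theorem exists_lift_tendsto_zero {t : ℕ → Torus} (ht : Tendsto t atTop (𝓝 0)) :
    ∃ v : ℕ → Fin 2 → ℝ, (∀ n, proj (v n) = t n) ∧ Tendsto v atTop (𝓝 0) := by
  have hlift : ∀ x : UnitAddCircle, ∃ y : ℝ, (y : UnitAddCircle) = x ∧ ‖y‖ = ‖x‖ := fun x => by
    obtain ⟨y, rfl⟩ := QuotientAddGroup.mk_surjective x
    have h : ((round y : ℝ) : UnitAddCircle) = 0 :=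
      (AddCircle.coe_eq_zero_iff (1 : ℝ)).2 ⟨round y, by simp⟩
    exact ⟨y - round y, by rw [AddCircle.coe_sub, h, sub_zero], UnitAddCircle.norm_eq.symm⟩
  choose l hl hnorm using hlift
  refine ⟨fun n i => l (t n i), fun n => funext fun i => hl _, ?_⟩
  rw [tendsto_pi_nhds] at ht ⊢
  refine fun i => tendsto_zero_iff_norm_tendsto_zero.2 ?_
  simpa only [hnorm, Pi.zero_apply, norm_zero] using (ht i).norm

/-- The linear automorphism of `ℝ²` given by `M`, which lifts `T`. -/
noncomputable def planarAut (M : GL (Fin 2) ℤ) : (Fin 2 → ℝ) →ₗ[ℝ] (Fin 2 → ℝ) :=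
  Matrix.toLin' (M.val.map (Int.cast : ℤ → ℝ))

theorem planarAut_apply (v : Fin 2 → ℝ) (i : Fin 2) :
    planarAut M v i = M.val i 0 * v 0 + M.val i 1 * v 1 := by
  simp [planarAut, Matrix.mulVec, dotProduct, Fin.sum_univ_two]

theorem proj_planarAut (v : Fin 2 → ℝ) : proj (planarAut M v) = toralAut M (proj v) :=
  (toralAut_proj M v).symm

theorem continuous_planarAut : Continuous (planarAut M) :=
  (planarAut M).continuous_of_finiteDimensional

theorem planarAut_planarAut (v : Fin 2 → ℝ) :
    planarAut M (planarAut M v) = (tr M : ℝ) • planarAut M v - (dt M : ℝ) • v := by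
  funext i
  fin_cases i <;>
  · simp [planarAut_apply, tr, dt, Matrix.trace_fin_two, Matrix.det_fin_two]
    ring

theorem planarAut_planarAut_inv (v : Fin 2 → ℝ) : planarAut M (planarAut M⁻¹ v) = v := by
  have h : M.val.map (Int.castRingHom ℝ) * (M⁻¹).val.map (Int.castRingHom ℝ) = 1 := by
    rw [← Matrix.map_mul, ← Units.val_mul, mul_inv_cancel, Units.val_one,
      Matrix.map_one _ (map_zero _) (map_one _)]
  change (M.val.map (Int.castRingHom ℝ)).mulVec (((M⁻¹).val.map (Int.castRingHom ℝ)).mulVec v) = v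
  rw [Matrix.mulVec_mulVec, h, Matrix.one_mulVec]

theorem toralAut_zpow_add (m n : ℤ) (x : Torus) :
    toralAut (M ^ (m + n)) x = toralAut (M ^ m) (toralAut (M ^ n) x) := by
  rw [← toralAut_mul, zpow_add]

theorem toralAut_zpow_proj {μ : ℝ} (hμ : μ ≠ 0) {w : Fin 2 → ℝ} (hw : planarAut M w = μ • w)
    (n : ℤ) : toralAut (M ^ n) (proj w) = proj (μ ^ n • w) := by
  have hstep : ∀ n : ℤ, proj (μ ^ (n + 1) • w) = toralAut M (proj (μ ^ n • w)) := fun n => by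
    rw [← proj_planarAut, map_smul, hw, smul_smul, zpow_add_one₀ hμ]
  induction n using Int.induction_on with
  | zero => simp [toralAut_one]
  | succ n ih => rw [add_comm, toralAut_zpow_add, zpow_one, ih, add_comm, hstep]
  | pred n ih =>
    have h := hstep (-n - 1)
    rw [sub_add_cancel, ← ih] at h
    rw [sub_eq_neg_add, toralAut_zpow_add, h, ← toralAut_mul, zpow_neg_one, inv_mul_cancel,
      toralAut_one, neg_add_eq_sub]

end Torus

section ContractingEigenvector

variable {M : GL (Fin 2) ℤ}

-- `A v - ν v` is an eigenvector of `A` for the expanding eigenvalue `μ`.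
theorem apply_eq_smul_of_tendsto_pow {V : Type*} [NormedAddCommGroup V] [NormedSpace ℝ V]
    {A : V →ₗ[ℝ] V} {μ ν : ℝ} (hμ : 1 < |μ|) (hA : ∀ v, A (A v) = (μ + ν) • A v - (μ * ν) • v)
    {v : V} (hv : Tendsto (fun k => (A ^ k) v) atTop (𝓝 0)) : A v = ν • v := by
  have hpow : ∀ k, (A ^ (k + 1)) v - ν • (A ^ k) v = μ ^ k • (A v - ν • v) := fun k => by
    induction k with
    | zero => simp
    | succ k ih =>
      rw [pow_succ' μ, mul_smul, ← ih, pow_succ' A (k + 1), pow_succ' A k]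
      simp only [Module.End.mul_apply, hA]
      module
  have hlim : Tendsto (fun k => ‖(A ^ (k + 1)) v - ν • (A ^ k) v‖) atTop (𝓝 0) := by
    simpa using ((hv.comp (tendsto_add_atTop_nat 1)).sub (hv.const_smul ν)).norm
  have hle : ‖A v - ν • v‖ ≤ 0 := ge_of_tendsto' hlim fun k => by
    rw [hpow, norm_smul, norm_pow, Real.norm_eq_abs]
    exact le_mul_of_one_le_left (norm_nonneg _) (one_le_pow₀ hμ.le)
  exact sub_eq_zero.1 (norm_le_zero_iff.1 hle)

theorem exists_tendsto_planarAut_pow {t : Torus}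
    (ht : Tendsto (fun n : ℕ => toralAut (M ^ n) t) atTop (𝓝 0)) :
    ∃ (N : ℕ) (v : Fin 2 → ℝ), proj v = toralAut (M ^ N) t ∧
      Tendsto (fun k => (planarAut M ^ k) v) atTop (𝓝 0) := by
  obtain ⟨v, hproj, hv⟩ := exists_lift_tendsto_zero ht
  have hdiff : Tendsto (fun n => planarAut M (v n) - v (n + 1)) atTop (𝓝 0) := by
    have h := (continuous_planarAut (M := M)).tendsto 0 |>.comp hv
    rw [map_zero] at h
    simpa using h.sub (hv.comp (tendsto_add_atTop_nat 1))
  have hstep : ∀ᶠ n in atTop, planarAut M (v n) = v (n + 1) := by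
    filter_upwards [Metric.tendsto_nhds.1 hdiff 1 one_pos] with n hn
    refine sub_eq_zero.1 (eq_zero_of_proj_eq_zero ?_ (by rwa [dist_zero_right] at hn))
    rw [proj_sub, proj_planarAut, hproj, hproj, pow_succ', toralAut_mul, sub_self]
  obtain ⟨N, hN⟩ := eventually_atTop.1 hstep
  have horbit : ∀ k, (planarAut M ^ k) (v N) = v (k + N) := fun k => by
    induction k with
    | zero => simp
    | succ k ih =>
      rw [pow_succ', Module.End.mul_apply, ih, hN _ (by omega)]
      congr 1
      omega
  refine ⟨N, v N, hproj N, ?_⟩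
  simpa only [horbit, Function.comp_def] using hv.comp (tendsto_add_atTop_nat N)

theorem exists_contracting_eigenvector {μ ν : ℝ} (hμ : 1 < |μ|) (hν : ν ≠ 0)
    (hadd : μ + ν = tr M) (hmul : μ * ν = dt M) {t : Torus}
    (ht : Tendsto (fun n : ℕ => toralAut (M ^ n) t) atTop (𝓝 0)) :
    ∃ s, planarAut M s = ν • s ∧ proj s = t := by
  obtain ⟨N, v, hproj, hv⟩ := exists_tendsto_planarAut_pow ht
  have hev : planarAut M v = ν • v :=
    apply_eq_smul_of_tendsto_pow hμ (fun u => by rw [planarAut_planarAut, hadd, hmul]) hv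
  refine ⟨ν ^ (-N : ℤ) • v, by rw [map_smul, hev, smul_comm], ?_⟩
  rw [← toralAut_zpow_proj hν hev, hproj, ← zpow_natCast, ← toralAut_zpow_add, neg_add_cancel,
    zpow_zero, toralAut_one]

end ContractingEigenvector

section Hyperbolic

variable {M : GL (Fin 2) ℤ}

theorem dt_eq_one_or (M : GL (Fin 2) ℤ) : dt M = 1 ∨ dt M = -1 :=
  Int.isUnit_iff.1 ((Matrix.isUnit_iff_isUnit_det _).1 M.isUnit)

theorem dt_inv (M : GL (Fin 2) ℤ) : dt M⁻¹ = dt M := by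
  have h : dt M * dt M⁻¹ = 1 := by
    rw [dt, dt, ← Matrix.det_mul, ← Units.val_mul, mul_inv_cancel, Units.val_one, Matrix.det_one]
  rcases dt_eq_one_or M with hd | hd <;> rw [hd] at h ⊢ <;> omega

theorem tr_inv (M : GL (Fin 2) ℤ) : tr M⁻¹ = dt M * tr M := by
  have hinv : Ring.inverse (dt M) = dt M := by
    rcases dt_eq_one_or M with h | h <;> rw [h]
    exacts [Ring.inverse_one ℤ, Ring.inverse_unit (-1 : ℤˣ)]
  rw [tr, Matrix.coe_units_inv, Matrix.inv_def, ← dt, hinv, Matrix.trace_smul,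
    Matrix.adjugate_fin_two, tr, Matrix.trace_fin_two, Matrix.trace_fin_two]
  simp [add_comm]

theorem mem_spectrum_of_root {z : ℂ} (hz : z ^ 2 - tr M * z + dt M = 0) :
    z ∈ spectrum ℂ (M.val.map (Int.cast : ℤ → ℂ)) := by
  rw [Matrix.mem_spectrum_iff_isRoot_charpoly, Matrix.charpoly_fin_two, Polynomial.IsRoot.def]
  simp only [Polynomial.eval_add, Polynomial.eval_sub, Polynomial.eval_pow, Polynomial.eval_X,
    Polynomial.eval_mul, Polynomial.eval_C]
  rw [← hz]
  simp [tr, dt, Matrix.trace_fin_two, Matrix.det_fin_two]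

namespace IsHyperbolic

theorem tr_ne_one (hM : IsHyperbolic M) (hd : dt M = 1) : tr M ≠ 1 := by
  intro h
  have h3 : ((√3 : ℝ) : ℂ) ^ 2 = 3 := by
    rw [← Complex.ofReal_pow, Real.sq_sqrt (by norm_num)]
    norm_num
  refine hM ((1 + √3 * Complex.I) / 2) (mem_spectrum_of_root ?_) ?_
  · rw [h, hd]
    push_cast
    linear_combination (1 / 4 : ℂ) * (√3 : ℂ) ^ 2 * Complex.I_sq - (1 / 4 : ℂ) * h3
  · rw [← pow_eq_one_iff_of_nonneg (norm_nonneg _) two_ne_zero, Complex.sq_norm,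
      Complex.normSq_div, ← Complex.ofReal_one, Complex.normSq_add_mul_I,
      Real.sq_sqrt (by norm_num)]
    norm_num

theorem tr_ne_two (hM : IsHyperbolic M) (hd : dt M = 1) : tr M ≠ 2 := by
  intro h
  refine hM 1 (mem_spectrum_of_root ?_) norm_one
  rw [h, hd]
  norm_num

theorem three_le_tr (hM : IsHyperbolic M) (hr : 0 < tr M) (hd : dt M = 1) : 3 ≤ tr M := by
  have h1 := hM.tr_ne_one hd
  have h2 := hM.tr_ne_two hd
  omega

theorem disc_pos (hM : IsHyperbolic M) (hr : 0 < tr M) : 0 < tr M ^ 2 - 4 * dt M := by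
  rcases dt_eq_one_or M with h | h
  · have h3 := hM.three_le_tr hr h
    rw [h]
    nlinarith
  · rw [h]
    nlinarith

-- The discriminant lies strictly between squares of integers of the same parity as the trace.
theorem not_isSquare_disc (hM : IsHyperbolic M) (hr : 0 < tr M) :
    ¬ IsSquare (tr M ^ 2 - 4 * dt M) := by
  rintro ⟨k, hk⟩
  have habs : |k| * |k| = tr M ^ 2 - 4 * dt M := by rw [abs_mul_abs_self, hk]
  have h0 := abs_nonneg k
  rcases dt_eq_one_or M with h | h
  · have h3 := hM.three_le_tr hr h
    have hlt : |k| < tr M := by nlinarith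
    have hgt : tr M - 1 < |k| := by nlinarith
    omega
  · have hlt : |k| < tr M + 2 := by nlinarith
    have hgt : tr M < |k| := by nlinarith
    have hk1 : |k| = tr M + 1 := by omega
    rw [hk1, h] at habs
    have : 2 * tr M = 3 := by linarith
    omega

theorem lam_sq (hM : IsHyperbolic M) (hr : 0 < tr M) : lam M ^ 2 = tr M * lam M - dt M := by
  have h : (0 : ℝ) ≤ (tr M : ℝ) ^ 2 - 4 * (dt M : ℝ) := mod_cast (hM.disc_pos hr).le
  rw [lam]
  linear_combination (1 / 4 : ℝ) * Real.sq_sqrt h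

theorem one_lt_lam (hM : IsHyperbolic M) (hr : 0 < tr M) : 1 < lam M := by
  have hdisc : (0 : ℝ) < (tr M : ℝ) ^ 2 - 4 * (dt M : ℝ) := mod_cast hM.disc_pos hr
  have hr1 : (1 : ℝ) ≤ tr M := mod_cast hr
  rw [lam]
  rcases dt_eq_one_or M with hd | hd
  · have h3 : (3 : ℝ) ≤ tr M := mod_cast hM.three_le_tr hr hd
    linarith [Real.sqrt_pos.2 hdisc]
  · have : (1 : ℝ) < √((tr M : ℝ) ^ 2 - 4 * (dt M : ℝ)) := by
      rw [Real.lt_sqrt one_pos.le, hd]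
      push_cast
      nlinarith
    linarith

theorem irrational_lam (hM : IsHyperbolic M) (hr : 0 < tr M) : Irrational (lam M) := by
  have h : Irrational √((tr M ^ 2 - 4 * dt M : ℤ) : ℝ) :=
    irrational_sqrt_intCast_iff.2 ⟨hM.not_isSquare_disc hr, (hM.disc_pos hr).le⟩
  have h2 := (h.intCast_add (tr M)).div_natCast two_ne_zero
  push_cast at h2
  exact h2

end IsHyperbolic

/-- The contracting eigenvalue `σ / λ` of `M`. -/
noncomputable def lamConj (M : GL (Fin 2) ℤ) : ℝ := dt M * (lam M)⁻¹

theorem lam_mul_lamConj (hl : 1 < lam M) : lam M * lamConj M = dt M := by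
  rw [lamConj]
  field_simp

theorem IsHyperbolic.lam_add_lamConj (hM : IsHyperbolic M) (hr : 0 < tr M) :
    lam M + lamConj M = tr M := by
  have hl := hM.one_lt_lam hr
  rw [lamConj]
  field_simp
  linear_combination hM.lam_sq hr

theorem abs_lamConj (hl : 1 < lam M) : |lamConj M| = (lam M)⁻¹ := by
  have hd : |(dt M : ℝ)| = 1 := by rcases dt_eq_one_or M with h | h <;> simp [h]
  rw [lamConj, abs_mul, hd, one_mul, abs_of_pos (by positivity)]

theorem lamConj_ne_zero (hl : 1 < lam M) : lamConj M ≠ 0 := by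
  rw [← abs_pos, abs_lamConj hl]
  positivity

end Hyperbolic

section Eigenlines

variable {M : GL (Fin 2) ℤ} {t : Torus} {w : Fin 2 → ℝ}

/-- The counterpart of `IsPlanarCoordinates` for the other eigenvalue: `s` is a vector of the
contracting eigenline of `M` that represents `t` modulo `ℤ²`. -/
def IsContractingCoordinates (M : GL (Fin 2) ℤ) (t : Torus) (s : Fin 2 → ℝ) : Prop :=
  planarAut M s = lamConj M • s ∧ proj s = t

theorem IsPlanarCoordinates.planarAut_eq (hw : IsPlanarCoordinates M t w) :
    planarAut M w = lam M • w := hw.1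

theorem IsHomoclinic.exists_isContractingCoordinates (hM : IsHyperbolic M) (hr : 0 < tr M)
    (ht : IsHomoclinic M t) : ∃ s, IsContractingCoordinates M t s := by
  have hl := hM.one_lt_lam hr
  refine exists_contracting_eigenvector (hl.trans_le (le_abs_self _)) (lamConj_ne_zero hl)
    (hM.lam_add_lamConj hr) (lam_mul_lamConj hl) ?_
  simpa only [Function.comp_def, zpow_natCast] using ht.1.comp tendsto_natCast_atTop_atTop

theorem IsHomoclinic.exists_isPlanarCoordinates (hM : IsHyperbolic M) (hr : 0 < tr M)
    (ht : IsHomoclinic M t) : ∃ w, IsPlanarCoordinates M t w := by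
  have hl := hM.one_lt_lam hr
  have hl0 : lam M ≠ 0 := by positivity
  have hn0 := lamConj_ne_zero hl
  have hd0 : (dt M : ℝ) ≠ 0 := lam_mul_lamConj hl ▸ mul_ne_zero hl0 hn0
  have hd2 : (dt M : ℝ) ^ 2 = 1 := by rcases dt_eq_one_or M with h | h <;> simp [h]
  have hadd : (lamConj M)⁻¹ + (lam M)⁻¹ = tr M⁻¹ := by
    rw [add_comm, inv_add_inv hl0 hn0, lam_mul_lamConj hl, hM.lam_add_lamConj hr, tr_inv]
    push_cast
    field_simp
    rw [hd2]
  have hmul : (lamConj M)⁻¹ * (lam M)⁻¹ = dt M⁻¹ := by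
    rw [← mul_inv_rev, lam_mul_lamConj hl, dt_inv]
    field_simp
    rw [hd2]
  have hlim : Tendsto (fun n : ℕ => toralAut (M⁻¹ ^ n) t) atTop (𝓝 0) := by
    simpa only [Function.comp_def, zpow_neg, zpow_natCast, ← inv_pow] using
      ht.2.comp (tendsto_neg_atTop_atBot.comp tendsto_natCast_atTop_atTop)
  obtain ⟨w, hw, hwt⟩ := exists_contracting_eigenvector (by rwa [abs_inv, abs_lamConj hl, inv_inv])
    (inv_ne_zero hl0) hadd hmul hlim
  refine ⟨w, ?_, hwt⟩
  have h := planarAut_planarAut_inv (M := M) w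
  rw [hw, map_smul] at h
  exact (inv_smul_eq_iff₀ hl0).1 h

theorem eq_zero_of_planarAut_eq_lam_smul (hirr : Irrational (lam M))
    (hw : planarAut M w = lam M • w) (h0 : proj w = 0) : w = 0 := by
  choose z hz using exists_int_of_proj_eq_zero h0
  by_contra hne
  obtain ⟨i, hi⟩ := Function.ne_iff.1 hne
  have h := congrFun hw i
  rw [planarAut_apply, Pi.smul_apply, smul_eq_mul, ← div_eq_iff hi] at h
  refine hirr ⟨(M.val i 0 * z 0 + M.val i 1 * z 1) / z i, ?_⟩
  push_cast
  rw [hz, hz, hz, h]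

theorem irrational_slope (hirr : Irrational (lam M)) (hw : planarAut M w = lam M • w)
    (hne : w ≠ 0) : w 0 ≠ 0 ∧ Irrational (w 1 / w 0) := by
  have h0 := congrFun hw 0
  have h1 := congrFun hw 1
  rw [planarAut_apply, Pi.smul_apply, smul_eq_mul] at h0 h1
  have hw0 : w 0 ≠ 0 := by
    intro hw0
    have hw1 : w 1 ≠ 0 := fun hw1 => hne (by funext i; fin_cases i <;> assumption)
    rw [hw0, mul_zero, zero_add] at h1
    exact hirr ⟨M.val 1 1, by exact_mod_cast mul_right_cancel₀ hw1 h1⟩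
  refine ⟨hw0, ?_⟩
  rintro ⟨q, hq⟩
  rw [eq_div_iff hw0] at hq
  refine hirr ⟨M.val 0 0 + M.val 0 1 * q, mul_right_cancel₀ hw0 ?_⟩
  rw [← h0, ← hq]
  push_cast
  ring

-- The line meets the circle `{x₀ = y₀}` in a coset of the subgroup generated by the slope.
theorem denseRange_proj_smul (hw0 : w 0 ≠ 0) (hslope : Irrational (w 1 / w 0)) :
    DenseRange fun x : ℝ => proj (x • w) := by
  intro y
  set α := w 1 / w 0 with hα
  obtain ⟨c, hc⟩ := QuotientAddGroup.mk_surjective (y 0)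
  have hdense : DenseRange fun n : ℤ => n • (α : UnitAddCircle) :=
    AddCircle.denseRange_zsmul_coe_iff.2 (by rwa [div_one])
  set g : UnitAddCircle → Torus := fun z => ![y 0, ((c * α : ℝ) : UnitAddCircle) + z] with hg
  have hcont : Continuous g := continuous_pi fun i => by
    fin_cases i
    · exact continuous_const
    · exact continuous_const_add _
  have hy : g (y 1 - ((c * α : ℝ) : UnitAddCircle)) = y := by
    funext i
    fin_cases i <;> simp [hg]
  rw [← hy]
  refine closure_mono ?_ (image_closure_subset_closure_image hcont
    (Set.mem_image_of_mem g (hdense (y 1 - ((c * α : ℝ) : UnitAddCircle)))))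
  rintro _ ⟨_, ⟨n, rfl⟩, rfl⟩
  refine ⟨(c + n) / w 0, funext fun i => ?_⟩
  fin_cases i
  · have hn : ((n : ℝ) : UnitAddCircle) = 0 := (AddCircle.coe_eq_zero_iff (1 : ℝ)).2 ⟨n, by simp⟩
    have hmul : (c + n) / w 0 * w 0 = c + n := div_mul_cancel₀ _ hw0
    simp only [hg, proj, Pi.smul_apply, smul_eq_mul, Fin.zero_eta, Matrix.cons_val_zero]
    rw [hmul, AddCircle.coe_add, hn, add_zero, ← hc]
  · have hmul : (c + n) / w 0 * w 1 = c * α + n • α := by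
      rw [hα, zsmul_eq_mul]
      ring
    simp only [hg, proj, Pi.smul_apply, smul_eq_mul, Fin.mk_one, Matrix.cons_val_one]
    rw [hmul, AddCircle.coe_add, AddCircle.coe_zsmul]
    rfl

-- In a compact group the closure of a half-line is a subgroup.
theorem dense_proj_smul_image_Ici (hw0 : w 0 ≠ 0) (hslope : Irrational (w 1 / w 0)) :
    Dense ((fun x : ℝ => proj (x • w)) '' Set.Ici 0) := by
  set H := (fun x : ℝ => proj (x • w)) '' Set.Ici 0
  refine dense_closure.1 ((denseRange_proj_smul hw0 hslope).mono ?_)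
  rintro _ ⟨x, rfl⟩
  rcases le_or_gt 0 x with hx | hx
  · exact subset_closure ⟨x, hx, rfl⟩
  set p := proj (-x • w) with hp
  have hmultiples : Set.range (fun n : ℕ => n • p) ⊆ H := by
    rintro _ ⟨n, rfl⟩
    exact ⟨n • -x, Set.mem_Ici.2 (nsmul_nonneg (by linarith) n), by
      simp only [hp, ← proj_nsmul, smul_assoc]⟩
  have hneg : proj (x • w) = (-1 : ℤ) • p := by
    rw [neg_one_zsmul, hp, ← zero_sub, ← proj_zero, ← proj_sub, neg_smul, zero_sub, neg_neg]
  refine closure_mono hmultiples ?_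
  rw [← closure_range_zsmul_eq_nsmul]
  exact subset_closure ⟨-1, hneg.symm⟩

end Eigenlines

section PrimarySpace

variable {M : GL (Fin 2) ℤ}

theorem mem_primarySubmonoid_of_finite {f : ℤ → ℕ} (hf : (Function.support f).Finite) :
    f ∈ primarySubmonoid M := by
  have hsum : ∀ g : ℕ → ℤ, Function.Injective g →
      Summable fun n : ℕ => (f (g n) : ℝ) * (lam M)⁻¹ ^ (n + 1) := fun g hg =>
    summable_of_hasFiniteSupport <| (hf.preimage hg.injOn).subset fun n hn h0 => hn <| by
      simp [show f (g n) = 0 from h0]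
  exact ⟨hsum _ fun i j h => by simpa using h, hsum _ fun i j h => by simpa using h⟩

theorem mem_primarySubmonoid_of_le (hl : 1 < lam M) {f : ℤ → ℕ} {C : ℕ} (hf : ∀ n, f n ≤ C) :
    f ∈ primarySubmonoid M :=
  ⟨summable_digits hl fun _ => hf _, summable_digits hl fun _ => hf _⟩

namespace PrimarySpace

theorem ext {e e' : PrimarySpace M} (h : e.seq = e'.seq) : e = e' := Subtype.ext h

theorem summable_pos (e : PrimarySpace M) :
    Summable fun n : ℕ => (e.seq (n + 1) : ℝ) * (lam M)⁻¹ ^ (n + 1) := (Subtype.property e).1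

theorem summable_neg (e : PrimarySpace M) :
    Summable fun n : ℕ => (e.seq (-(n + 1)) : ℝ) * (lam M)⁻¹ ^ (n + 1) := (Subtype.property e).2

theorem seq_zero : (0 : PrimarySpace M).seq = 0 := rfl

/-- The underlying sequence, as an additive homomorphism; used to compute the digits of finite
sums. -/
def seqHom (M : GL (Fin 2) ℤ) : PrimarySpace M →+ (ℤ → ℕ) where
  toFun := seq
  map_zero' := rfl
  map_add' := seq_add

theorem isInducing : IsInducing
    (fun e : PrimarySpace M => ((e.seq, e.sumPos, e.sumNeg) : (ℤ → ℕ) × ℝ × ℝ)) := ⟨rfl⟩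

theorem continuous_seq : Continuous (seq : PrimarySpace M → ℤ → ℕ) :=
  continuous_fst.comp isInducing.continuous

theorem continuous_digit (n : ℤ) : Continuous fun e : PrimarySpace M => (e.seq n : ℝ) :=
  continuous_of_discreteTopology.comp ((continuous_apply n).comp continuous_seq)

theorem continuous_sumPos : Continuous (sumPos : PrimarySpace M → ℝ) :=
  (continuous_fst.comp continuous_snd).comp isInducing.continuous

theorem continuous_sumNeg : Continuous (sumNeg : PrimarySpace M → ℝ) :=
  (continuous_snd.comp continuous_snd).comp isInducing.continuous

theorem tendsto_of_eventually_eq {ι : Type*} {l : Filter ι} {u : ι → PrimarySpace M}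
    {e : PrimarySpace M} (h : ∀ n, ∀ᶠ i in l, (u i).seq n = e.seq n)
    (hpos : Tendsto (fun i => (u i).sumPos) l (𝓝 e.sumPos))
    (hneg : Tendsto (fun i => (u i).sumNeg) l (𝓝 e.sumNeg)) : Tendsto u l (𝓝 e) := by
  rw [isInducing.tendsto_nhds_iff]
  exact (tendsto_pi_nhds.2 fun n => tendsto_const_nhds.congr' (EventuallyEq.symm (h n))).prodMk_nhds
    (hpos.prodMk_nhds hneg)

theorem isCompact_of_isClosed_of_le (hl : 1 < lam M) {C : Set (ℤ → ℕ)} (hC : IsClosed C) {R : ℕ}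
    (hR : ∀ f ∈ C, ∀ n, f n ≤ R) : IsCompact {e : PrimarySpace M | e.seq ∈ C} := by
  have hK : IsCompact C := (isCompact_univ_pi (s := fun _ : ℤ => Set.Iic R) fun _ =>
    (Set.finite_Iic R).isCompact).of_isClosed_subset hC fun f hf n _ => hR f hf n
  have := isCompact_iff_compactSpace.1 hK
  let g : C → PrimarySpace M := fun f => ⟨f.1, mem_primarySubmonoid_of_le hl (hR f.1 f.2)⟩
  have hsum : ∀ p : ℕ → ℤ,
      Continuous fun f : C => ∑' n : ℕ, (f.1 (p n) : ℝ) * (lam M)⁻¹ ^ (n + 1) := fun p => by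
    refine continuous_tsum (fun n => ?_) (summable_digits hl (b := fun _ => R) fun _ => le_rfl)
      fun n f => ?_
    · exact (continuous_of_discreteTopology.comp
        ((continuous_apply (p n)).comp continuous_subtype_val)).mul_const _
    · have : 0 ≤ (lam M)⁻¹ := inv_nonneg.2 (zero_lt_one.trans hl).le
      rw [Real.norm_of_nonneg (by positivity)]
      gcongr
      exact hR f.1 f.2 (p n)
  have hg : Continuous g :=
    isInducing.continuous_iff.2 (continuous_subtype_val.prodMk ((hsum _).prodMk (hsum _)))
  refine (isCompact_range hg).of_isClosed_subset (hC.preimage continuous_seq) fun e he => ?_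
  exact ⟨⟨e.seq, he⟩, rfl⟩

end PrimarySpace

/-- The sequence with the digit `1` at the position `n` and zeros elsewhere. -/
noncomputable def single (M : GL (Fin 2) ℤ) (n : ℤ) : PrimarySpace M :=
  ⟨Pi.single n 1, mem_primarySubmonoid_of_finite
    ((Set.finite_singleton n).subset Pi.support_single_subset)⟩

theorem single_seq (n m : ℤ) : (single M n).seq m = if m = n then 1 else 0 := Pi.single_apply n 1 m

theorem shift_single (n : ℤ) : shift (single M (n + 1)) = single M n := by
  refine PrimarySpace.ext (funext fun m => ?_)
  simp [shift_seq, single_seq]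

theorem sumPos_single (n : ℤ) :
    (single M n).sumPos = if 0 < n then (lam M)⁻¹ ^ n.toNat else 0 := by
  rw [sumPos, tsum_eq_single (n.toNat - 1)]
  · split_ifs with hn
    · simp [single_seq, show ((n.toNat - 1 : ℕ) : ℤ) + 1 = n by omega,
        show n.toNat - 1 + 1 = n.toNat by omega]
    · rw [single_seq, if_neg (by omega), Nat.cast_zero, zero_mul]
  · intro k hk
    rw [single_seq, if_neg (by omega), Nat.cast_zero, zero_mul]

theorem sumNeg_single (n : ℤ) : (single M n).sumNeg = (single M (-n)).sumPos := by
  simp only [sumNeg, sumPos, single_seq, neg_eq_iff_eq_neg]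

theorem tendsto_single (hl : 1 < lam M) : Tendsto (single M) cofinite (𝓝 0) := by
  have hzero : (0 : PrimarySpace M).sumPos = 0 ∧ (0 : PrimarySpace M).sumNeg = 0 := by
    simp [sumPos, sumNeg, seq_zero]
  have hpos : Tendsto (fun n => (single M n).sumPos) cofinite (𝓝 0) := by
    simp only [sumPos_single, Int.cofinite_eq, tendsto_sup]
    constructor
    · refine tendsto_const_nhds.congr' ?_
      filter_upwards [eventually_le_atBot 0] with n hn
      rw [if_neg hn.not_gt]
    · rw [← Nat.map_cast_int_atTop, tendsto_map'_iff]
      refine (tendsto_pow_atTop_nhds_zero_of_lt_one (inv_nonneg.2 (zero_lt_one.trans hl).le)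
        (inv_lt_one_of_one_lt₀ hl)).congr' ?_
      filter_upwards [eventually_gt_atTop 0] with n hn
      simp [hn]
  refine tendsto_of_eventually_eq (fun m => ?_) (by rwa [hzero.1]) ?_
  · filter_upwards [eventually_cofinite_ne m] with n hn
    simp [single_seq, hn.symm, seq_zero]
  · simp only [hzero.2, sumNeg_single]
    exact hpos.comp neg_injective.tendsto_cofinite

/-- The restriction of a sequence to the positions `-k, …, k`. -/
noncomputable def trunc (e : PrimarySpace M) (k : ℕ) : PrimarySpace M :=
  ∑ n ∈ Finset.Icc (-(k : ℤ)) k, e.seq n • single M n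

theorem trunc_seq (e : PrimarySpace M) (k : ℕ) (m : ℤ) :
    (trunc e k).seq m = if m ∈ Finset.Icc (-(k : ℤ)) k then e.seq m else 0 := by
  have h : ∀ n, seqHom M (e.seq n • single M n) m = if m = n then e.seq n else 0 := fun n => by
    have hs : seqHom M (single M n) m = if m = n then 1 else 0 :=
      single_seq (M := M) n m
    rw [map_nsmul, Pi.smul_apply, hs, smul_eq_mul, mul_ite, mul_one, mul_zero]
  calc (trunc e k).seq m
      = ∑ n ∈ Finset.Icc (-(k : ℤ)) k, seqHom M (e.seq n • single M n) m := by
        rw [← Finset.sum_apply, ← map_sum]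
        rfl
    _ = _ := by simp only [h, Finset.sum_ite_eq]

theorem tendsto_tsum_ite_lt {f : ℕ → ℝ} (hf : Summable f) :
    Tendsto (fun k => ∑' n, if n < k then f n else 0) atTop (𝓝 (∑' n, f n)) := by
  refine hf.hasSum.tendsto_sum_nat.congr fun k => ?_
  rw [tsum_eq_sum (s := Finset.range k) fun n hn => if_neg (mt Finset.mem_range.2 hn)]
  exact Finset.sum_congr rfl fun n hn => (if_pos (Finset.mem_range.1 hn)).symm

theorem tendsto_trunc (e : PrimarySpace M) : Tendsto (trunc e) atTop (𝓝 e) := by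
  refine tendsto_of_eventually_eq (fun n => ?_) ?_ ?_
  · filter_upwards [eventually_ge_atTop n.natAbs] with k hk
    rw [trunc_seq, if_pos (Finset.mem_Icc.2 (by omega))]
  · refine (tendsto_tsum_ite_lt e.summable_pos).congr fun k => tsum_congr fun n => ?_
    simp only [trunc_seq, Finset.mem_Icc,
      show (-(k : ℤ) ≤ n + 1 ∧ (n : ℤ) + 1 ≤ k) ↔ n < k by omega]
    split_ifs <;> simp
  · refine (tendsto_tsum_ite_lt e.summable_neg).congr fun k => tsum_congr fun n => ?_
    simp only [trunc_seq, Finset.mem_Icc,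
      show (-(k : ℤ) ≤ -(n + 1) ∧ -((n : ℤ) + 1) ≤ k) ↔ n < k by omega]
    split_ifs <;> simp

-- The tails of the dominating series tend to zero, and continuously so, which is what makes the
-- partial sums of `∑ f n` approximate locally uniformly.
theorem continuous_tsum_of_le {X : Type*} [TopologicalSpace X] {f g : ℕ → X → ℝ}
    (hf : ∀ n, Continuous (f n)) (hg : ∀ n, Continuous (g n)) (hfg : ∀ n x, |f n x| ≤ g n x)
    (hs : ∀ x, Summable fun n => g n x) (hc : Continuous fun x => ∑' n, g n x) :
    Continuous fun x => ∑' n, f n x := by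
  refine continuous_of_locally_uniform_approx_of_continuousAt fun x u hu => ?_
  obtain ⟨δ, hδ, hu⟩ := Metric.mem_uniformity_dist.1 hu
  have hrem : ∀ N, Continuous fun y => ∑' n, g n y - ∑ n ∈ Finset.range N, g n y := fun N =>
    hc.sub (continuous_finsetSum _ fun n _ => hg n)
  have hlim : Tendsto (fun N => ∑' n, g n x - ∑ n ∈ Finset.range N, g n x) atTop (𝓝 0) := by
    simpa using (hs x).hasSum.tendsto_sum_nat.const_sub (∑' n, g n x)
  obtain ⟨N, hN⟩ := (hlim.eventually (gt_mem_nhds hδ)).exists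
  refine ⟨{y | ∑' n, g n y - ∑ n ∈ Finset.range N, g n y < δ},
    (hrem N).continuousAt.eventually (gt_mem_nhds hN),
    fun y => ∑ n ∈ Finset.range N, f n y,
    (continuous_finsetSum _ fun n _ => hf n).continuousAt, fun y hy => hu ?_⟩
  have hsf : Summable fun n => f n y := Summable.of_norm_bounded (hs y) fun n => hfg n y
  calc dist (∑' n, f n y) (∑ n ∈ Finset.range N, f n y)
      = ‖∑' n, f (n + N) y‖ := by
        rw [Real.dist_eq, ← hsf.sum_add_tsum_nat_add N, add_sub_cancel_left, Real.norm_eq_abs]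
    _ ≤ ∑' n, g (n + N) y :=
        tsum_of_norm_bounded ((summable_nat_add_iff N).2 (hs y)).hasSum fun n => hfg (n + N) y
    _ = ∑' n, g n y - ∑ n ∈ Finset.range N, g n y := by
        rw [← (hs y).sum_add_tsum_nat_add N, add_sub_cancel_left]
    _ < δ := hy

/-- The sum `∑_{n ≥ 0} ε_n λ^{-n}`: the part of the coding that is summed along the expanding
eigenline. -/
noncomputable def expandSum (e : PrimarySpace M) : ℝ := e.seq 0 + e.sumPos

/-- The sum `∑_{n ≥ 1} ε_{-n} (σ / λ)^n`: the part of the coding that is summed along the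
contracting eigenline. -/
noncomputable def contractSum (e : PrimarySpace M) : ℝ :=
  ∑' n : ℕ, (e.seq (-(n + 1)) : ℝ) * lamConj M ^ (n + 1)

theorem hasSum_expandSum (e : PrimarySpace M) :
    HasSum (fun n : ℕ => (e.seq n : ℝ) * (lam M)⁻¹ ^ n) (expandSum e) := by
  rw [← hasSum_nat_add_iff' 1]
  simpa [expandSum, sumPos] using e.summable_pos.hasSum

theorem expandSum_eq_mul_digitSum (hl : lam M ≠ 0) (e : PrimarySpace M) :
    expandSum e = lam M * digitSum (lam M) (tail e.seq 0) := by
  rw [← (hasSum_expandSum e).tsum_eq, digitSum, ← tsum_mul_left]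
  refine tsum_congr fun n => ?_
  rw [tail, zero_add, pow_succ]
  field_simp

theorem continuous_expandSum : Continuous (expandSum : PrimarySpace M → ℝ) :=
  (continuous_digit 0).add continuous_sumPos

theorem expandSum_add (e e' : PrimarySpace M) :
    expandSum (e + e') = expandSum e + expandSum e' :=
  (hasSum_expandSum _).unique <| ((hasSum_expandSum e).add (hasSum_expandSum e')).congr_fun
    fun n => by simp [seq_add, add_mul]

theorem expandSum_shift (hl : lam M ≠ 0) (e : PrimarySpace M) :
    expandSum (shift e) = lam M * (expandSum e - e.seq 0) := by
  have h := (hasSum_nat_add_iff' 1).2 (hasSum_expandSum e)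
  rw [Finset.sum_range_one, Nat.cast_zero, pow_zero, mul_one] at h
  refine (hasSum_expandSum _).unique ((h.mul_left (lam M)).congr_fun fun n => ?_)
  rw [shift_seq, Nat.cast_succ, pow_succ]
  field_simp

theorem abs_contract_le (hl : 1 < lam M) (e : PrimarySpace M) (n : ℕ) :
    |(e.seq (-(n + 1)) : ℝ) * lamConj M ^ (n + 1)| ≤
      (e.seq (-(n + 1)) : ℝ) * (lam M)⁻¹ ^ (n + 1) := by
  rw [abs_mul, abs_pow, abs_lamConj hl, Nat.abs_cast]

theorem hasSum_contractSum (hl : 1 < lam M) (e : PrimarySpace M) :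
    HasSum (fun n : ℕ => (e.seq (-(n + 1)) : ℝ) * lamConj M ^ (n + 1)) (contractSum e) :=
  (Summable.of_norm_bounded e.summable_neg (abs_contract_le hl e)).hasSum

theorem continuous_contractSum (hl : 1 < lam M) :
    Continuous (contractSum : PrimarySpace M → ℝ) :=
  continuous_tsum_of_le (fun _ => (continuous_digit _).mul_const _)
    (fun _ => (continuous_digit _).mul_const _) (fun n e => abs_contract_le hl e n)
    PrimarySpace.summable_neg continuous_sumNeg

theorem contractSum_add (hl : 1 < lam M) (e e' : PrimarySpace M) :
    contractSum (e + e') = contractSum e + contractSum e' :=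
  (hasSum_contractSum hl _).unique <|
    ((hasSum_contractSum hl e).add (hasSum_contractSum hl e')).congr_fun
      fun n => by simp [seq_add, add_mul]

theorem contractSum_shift (hl : 1 < lam M) (e : PrimarySpace M) :
    contractSum (shift e) = lamConj M * (e.seq 0 + contractSum e) := by
  have h := (hasSum_contractSum hl e).mul_left (lamConj M)
  refine (hasSum_contractSum hl _).unique ((hasSum_nat_add_iff' 1).1 ?_)
  have hval : lamConj M * (e.seq 0 + contractSum e) -
      ∑ n ∈ Finset.range 1, ((shift e).seq (-(n + 1)) : ℝ) * lamConj M ^ (n + 1) =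
        lamConj M * contractSum e := by
    simp [shift_seq]
    ring
  rw [hval]
  refine h.congr_fun fun n => ?_
  rw [shift_seq, show (-(((n + 1 : ℕ) : ℤ) + 1) + 1 : ℤ) = -((n : ℤ) + 1) by push_cast; ring]
  ring

theorem isClosed_admissible (a : ℕ → ℕ) : IsClosed {e | Admissible a e} := by
  simp only [Admissible, lexLE_iff, Set.ofPred_forall]
  refine isClosed_iInter fun n => isClosed_iInter fun j => ?_
  have hc : ∀ i, Continuous fun e : ℤ → ℕ => tail e n i := fun i => continuous_apply _
  have hopen : IsOpen {e | ∀ i < j, tail e n i = a i} := by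
    simp only [Set.ofPred_forall]
    exact (Set.finite_Iio j).isOpen_biInter fun i _ => (isOpen_discrete {a i}).preimage (hc i)
  simpa only [← Set.ofPred_forall] using
    isClosed_imp hopen (isClosed_le (hc j) continuous_const)

theorem isCompact_admissible (hl : 1 < lam M) (a : ℕ → ℕ) :
    IsCompact {e : PrimarySpace M | Admissible a e.seq} :=
  isCompact_of_isClosed_of_le hl (isClosed_admissible a) fun _ he => he.le_zero

theorem isTotal_admissible (a : ℕ → ℕ) : IsTotal {e : PrimarySpace M | Admissible a e.seq} := by
  rintro e he e' ⟨N, hN⟩ n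
  have h := hN (n - N)
  rw [add_sub_cancel] at h
  exact h.trans (he N)

theorem shift_image_admissible (hl : 1 < lam M) (a : ℕ → ℕ) :
    shift '' {e : PrimarySpace M | Admissible a e.seq} = {e | Admissible a e.seq} := by
  refine Set.Subset.antisymm ?_ fun e he => ?_
  · rintro _ ⟨e, he, rfl⟩ n
    have htail : tail (shift e).seq n = tail e.seq (n + 1) :=
      funext fun k => by rw [tail, tail, shift_seq, add_right_comm]
    exact htail ▸ he (n + 1)
  · refine ⟨⟨fun n => e.seq (n - 1), mem_primarySubmonoid_of_le hl fun n => he.le_zero _⟩,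
      fun n => ?_, PrimarySpace.ext (funext fun n => congrArg e.seq (add_sub_cancel_right n 1))⟩
    convert he (n - 1) using 1
    exact funext fun k => congrArg e.seq (add_sub_right_comm n k 1)

theorem Admissible.trunc {a : ℕ → ℕ} {e : PrimarySpace M} (he : Admissible a e.seq) (k : ℕ) :
    Admissible a (trunc e k).seq := by
  intro n
  refine lexLE_iff.2 fun j hj => ?_
  simp only [tail, trunc_seq, Finset.mem_Icc] at hj ⊢
  split_ifs with hm
  · rcases lt_or_ge n (-k) with hn | hn
    · have h := hj 0 (by omega)
      rw [if_neg (by omega)] at h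
      have := he.le_zero (n + j)
      omega
    · refine lexLE_iff.1 (he n) j fun i hi => ?_
      rw [← hj i hi, if_pos (by omega), tail]
  · exact Nat.zero_le _

end PrimarySpace

section Compactum

theorem isQuasiGreedy_markov {β : ℝ} (hβ : 1 < β) {r : ℕ} (h : β ^ 2 = r * β + 1) :
    IsQuasiGreedy β (fun j => if Even j then r else 0) := by
  have : 0 < β := zero_lt_one.trans hβ
  refine .of_remainders (y := fun k => if Even k then 1 else β⁻¹) hβ (fun k => ?_) (by simp)
    (fun k => ?_) fun k => ?_
  · by_cases hk : Even k <;> simp only [hk, Nat.even_add_one, if_true, if_false, not_true_eq_false,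
      not_false_eq_true] <;> field_simp <;> push_cast <;> linarith
  · split_ifs <;> positivity
  · split_ifs
    exacts [le_rfl, (inv_lt_one_of_one_lt₀ hβ).le]

theorem isQuasiGreedy_sofic {β : ℝ} (hβ : 1 < β) {r : ℕ} (h : β ^ 2 = r * β - 1) :
    IsQuasiGreedy β (fun j => if j = 0 then r - 1 else r - 2) := by
  have hpos : 0 < β := zero_lt_one.trans hβ
  have hr : 2 ≤ r := by
    have : (2 : ℝ) < r := by nlinarith [sq_pos_of_pos (sub_pos.2 hβ)]
    exact_mod_cast this.le
  have hy : β - (r - 1) = 1 - β⁻¹ := by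
    field_simp
    linarith
  refine .of_remainders (y := fun k => if k = 0 then 1 else β - (r - 1)) hβ (fun k => ?_)
    (if_pos rfl) (fun k => ?_) fun k => ?_
  · rcases k.eq_zero_or_pos with rfl | hk
    · push_cast [Nat.cast_sub (one_le_two.trans hr)]
      simp
    · simp only [hk.ne', if_false, Nat.succ_ne_zero]
      push_cast [Nat.cast_sub hr]
      linarith
  · split_ifs
    exacts [one_pos, hy ▸ sub_pos.2 (inv_lt_one_of_one_lt₀ hβ)]
  · split_ifs
    exacts [le_rfl, hy ▸ sub_le_self _ (inv_nonneg.2 hpos.le)]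

theorem admissible_iff_mem_markovCompactum {r : ℕ} {e : ℤ → ℕ} :
    Admissible (fun j => if Even j then r else 0) e ↔ e ∈ markovCompactum r := by
  simp only [Admissible, lexLE_iff, tail]
  constructor
  · intro h n
    refine ⟨by simpa using h n 0 (by simp), fun hn => ?_⟩
    simpa using h n 1 fun i hi => by
      obtain rfl : i = 0 := by omega
      simpa using hn
  · intro h n j hj
    by_cases hev : Even j
    · simpa [hev] using (h (n + j)).1
    obtain ⟨i, rfl⟩ : ∃ i, j = i + 1 := Nat.exists_eq_succ_of_ne_zero fun h0 => hev (by simp [h0])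
    have hi : e (n + i) = r :=
      (hj i i.lt_succ_self).trans (if_pos (by simpa [parity_simps] using hev))
    have hzero := (h (n + i)).2 (mod_cast hi)
    rw [Nat.cast_add, Nat.cast_one, ← add_assoc, hzero]
    exact Nat.zero_le _

theorem admissible_iff_mem_soficCompactum {r : ℕ} (hr : 2 ≤ r) {e : ℤ → ℕ} :
    Admissible (fun j => if j = 0 then r - 1 else r - 2) e ↔ e ∈ soficCompactum r := by
  simp only [Admissible, lexLE_iff, tail]
  constructor
  · intro h n
    have h0 : e n ≤ r - 1 := by simpa using h n 0 (by simp)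
    refine ⟨by omega, fun s => ?_⟩
    rintro ⟨hfirst, hmid, hlast⟩
    have hlast' := h n (s + 1) fun i hi => by
      split_ifs with hi0
      · simp only [hi0, Nat.cast_zero, add_zero]
        omega
      · have := hmid i (by omega) (by omega)
        omega
    rw [if_neg (by omega), Nat.cast_add, Nat.cast_one, ← add_assoc] at hlast'
    omega
  · intro h n j hj
    have hle := (h (n + j)).1
    split_ifs with hj0
    · omega
    by_contra! hlt
    refine (h n).2 (j - 1) ⟨?_, fun i hi hi' => ?_, ?_⟩
    · have := hj 0 (by omega)
      simp only [Nat.cast_zero, add_zero, if_true] at this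
      omega
    · have := hj i (by omega)
      rw [if_neg (by omega)] at this
      omega
    · rw [show n + ((j - 1 : ℕ) : ℤ) + 1 = n + j by omega]
      omega

variable {M : GL (Fin 2) ℤ}

/-- The quasi-greedy expansion of `1` in base `λ`: `r, 0, r, 0, …` if `det M = -1` and
`r - 1, r - 2, r - 2, …` otherwise. -/
def critSeq (M : GL (Fin 2) ℤ) : ℕ → ℕ :=
  if dt M = -1 then fun j => if Even j then (tr M).toNat else 0
  else fun j => if j = 0 then (tr M).toNat - 1 else (tr M).toNat - 2

theorem isQuasiGreedy_critSeq (hM : IsHyperbolic M) (hr : 0 < tr M) :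
    IsQuasiGreedy (lam M) (critSeq M) := by
  have hsq := hM.lam_sq hr
  have hl := hM.one_lt_lam hr
  have hcast : ((tr M).toNat : ℝ) = tr M := mod_cast Int.toNat_of_nonneg hr.le
  rcases dt_eq_one_or M with h | h
  · rw [critSeq, if_neg (by omega)]
    exact isQuasiGreedy_sofic hl (by rw [hsq, hcast, h, Int.cast_one])
  · rw [critSeq, if_pos h]
    exact isQuasiGreedy_markov hl (by rw [hsq, hcast, h]; simp)

theorem admissible_critSeq_iff (hM : IsHyperbolic M) (hr : 0 < tr M) {e : ℤ → ℕ} :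
    Admissible (critSeq M) e ↔ e ∈ compactum M := by
  have hcast : ((tr M).toNat : ℤ) = tr M := Int.toNat_of_nonneg hr.le
  rcases dt_eq_one_or M with h | h
  · have := hM.three_le_tr hr h
    rw [compactum, critSeq, if_neg (by omega), if_neg (by omega),
      admissible_iff_mem_soficCompactum (by omega), hcast]
  · rw [compactum, critSeq, if_pos h, if_pos h, admissible_iff_mem_markovCompactum, hcast]

theorem setOf_mem_compactum_eq (hM : IsHyperbolic M) (hr : 0 < tr M) :
    {e : PrimarySpace M | e.seq ∈ compactum M} = {e | Admissible (critSeq M) e.seq} :=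
  Set.ext fun _ => (admissible_critSeq_iff hM hr).symm

theorem seq_image_compactum (hM : IsHyperbolic M) (hr : 0 < tr M) :
    PrimarySpace.seq '' {e : PrimarySpace M | e.seq ∈ compactum M} = compactum M := by
  refine Set.image_preimage_eq_of_subset fun e he => ?_
  have hle := ((admissible_critSeq_iff hM hr).2 he).le_zero
  exact ⟨⟨e, mem_primarySubmonoid_of_le (hM.one_lt_lam hr) hle⟩, rfl⟩

-- A truncated admissible sequence drops below `a` after boundedly many digits, so that finitely
-- many digits of `a` suffice for the comparison.
theorem admissible_subset_of_matching {a : ℕ → ℕ} {β : ℝ} (ha : IsQuasiGreedy β a)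
    {X : Set (PrimarySpace M)} (hX : IsClosed X) (htot : IsTotal X)
    (hmatch : ∀ m, ∃ e ∈ X, ∃ n : ℤ, ∀ i < m, tail e.seq n i = a i) :
    {e : PrimarySpace M | Admissible a e.seq} ⊆ X := by
  intro e he
  refine hX.mem_of_tendsto (tendsto_trunc e) (Eventually.of_forall fun k => ?_)
  obtain ⟨J, hJ, haJ⟩ := ha.exists_pos_of_le (2 * k + 1)
  obtain ⟨e₀, he₀, n₀, hmatch⟩ := hmatch (J + 1)
  refine htot e₀ he₀ _ ⟨n₀, fun l => ?_⟩
  obtain ⟨j, hj, heq, hlt⟩ : ∃ j ≤ J, (∀ i < j, tail (trunc e k).seq (n₀ + l) i = a i) ∧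
      tail (trunc e k).seq (n₀ + l) j < a j := by
    rcases lt_or_ge (n₀ + l) (-k) with hn | hn
    · refine ⟨0, Nat.zero_le _, by simp, ?_⟩
      rw [tail, trunc_seq, if_neg (by rw [Finset.mem_Icc]; omega)]
      exact ha.zero_pos
    · refine (he.trunc k (n₀ + l)).exists_lt ?_
      rw [tail, trunc_seq, if_neg (by rw [Finset.mem_Icc]; omega)]
      exact haJ.ne
  exact Or.inr ⟨j, fun i hi => (heq i hi).trans (hmatch i (by omega)).symm,
    hlt.trans_eq (hmatch j (by omega)).symm⟩

end Compactum

section CodingMap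

variable {M : GL (Fin 2) ℤ} {t : Torus} {w s : Fin 2 → ℝ}

theorem sum_Icc_neg_natCast {A : Type*} [AddCommMonoid A] (f : ℤ → A) (k l : ℕ) :
    ∑ n ∈ Finset.Icc (-(k : ℤ)) l, f n =
      ∑ n ∈ Finset.range (l + 1), f n + ∑ n ∈ Finset.range k, f (-(n + 1)) := by
  induction k with
  | zero =>
    rw [Finset.range_zero, Finset.sum_empty, add_zero]
    refine (Finset.sum_nbij (fun n : ℕ => (n : ℤ)) ?_ ?_ ?_ fun _ _ => rfl).symm
    · intro n hn
      simp only [Finset.mem_range, Finset.mem_Icc] at hn ⊢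
      omega
    · exact Nat.cast_injective.injOn
    · intro n hn
      simp only [Finset.coe_Icc, Set.mem_Icc] at hn
      exact ⟨n.toNat, by simp only [Finset.coe_range, Set.mem_Iio]; omega, by dsimp only; omega⟩
  | succ k ih =>
    have h : Finset.Icc (-((k + 1 : ℕ) : ℤ)) l =
        insert (-((k : ℤ) + 1)) (Finset.Icc (-(k : ℤ)) l) := by
      ext n
      simp only [Finset.mem_Icc, Finset.mem_insert]
      omega
    rw [h, Finset.sum_insert (by simp), ih, Finset.sum_range_succ _ k]
    abel

theorem sum_nsmul_toralAut_zpow_proj {ι : Type*} {μ : ℝ} {v : Fin 2 → ℝ} (hμ : μ ≠ 0)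
    (hv : planarAut M v = μ • v) (S : Finset ι) (f : ι → ℕ) (g : ι → ℤ) :
    ∑ i ∈ S, f i • toralAut (M ^ g i) (proj v) = proj ((∑ i ∈ S, (f i : ℝ) * μ ^ g i) • v) := by
  rw [Finset.sum_smul]
  refine (Finset.sum_congr rfl fun i _ => ?_).trans
    (map_sum (AddMonoidHom.mk' proj proj_add) _ S).symm
  rw [toralAut_zpow_proj hμ hv, ← proj_nsmul, mul_smul, Nat.cast_smul_eq_nsmul]
  rfl

theorem tendsto_sum_nsmul_toralAut (hl : 1 < lam M) (hw : IsPlanarCoordinates M t w)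
    (hs : IsContractingCoordinates M t s) (e : PrimarySpace M) :
    Tendsto (fun p : ℕ × ℕ => ∑ n ∈ Finset.Icc (-(p.1 : ℤ)) (p.2 : ℤ),
      e.seq n • toralAut (M ^ (-n)) t) atTop
      (𝓝 (proj (expandSum e • w + contractSum e • s))) := by
  have hsum : ∀ p : ℕ × ℕ, ∑ n ∈ Finset.Icc (-(p.1 : ℤ)) (p.2 : ℤ),
      e.seq n • toralAut (M ^ (-n)) t = proj
        ((∑ n ∈ Finset.range (p.2 + 1), (e.seq n : ℝ) * (lam M)⁻¹ ^ n) • w +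
        (∑ n ∈ Finset.range p.1, (e.seq (-(n + 1)) : ℝ) * lamConj M ^ (n + 1)) • s) := by
    intro p
    have hexpand := sum_nsmul_toralAut_zpow_proj (one_pos.trans hl).ne' hw.planarAut_eq
      (Finset.range (p.2 + 1)) (fun n => e.seq n) fun n => -n
    have hcontract := sum_nsmul_toralAut_zpow_proj (lamConj_ne_zero hl) hs.1
      (Finset.range p.1) (fun n => e.seq (-(n + 1))) fun n => n + 1
    rw [hw.2] at hexpand
    rw [hs.2] at hcontract
    rw [sum_Icc_neg_natCast, proj_add, hexpand]
    simp only [neg_neg, zpow_neg, zpow_natCast, inv_pow, hcontract]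
    norm_cast
  simp only [hsum]
  have hatTop : Tendsto (Prod.fst : ℕ × ℕ → ℕ) atTop atTop ∧
      Tendsto (Prod.snd : ℕ × ℕ → ℕ) atTop atTop := by
    rw [← prod_atTop_atTop_eq]
    exact ⟨tendsto_fst, tendsto_snd⟩
  exact (continuous_proj.tendsto _).comp <| Tendsto.add
    (((hasSum_expandSum e).tendsto_sum_nat.comp
      ((tendsto_add_atTop_nat 1).comp hatTop.2)).smul_const w)
    (((hasSum_contractSum hl e).tendsto_sum_nat.comp hatTop.1).smul_const s)

theorem codingMap_eq (hl : 1 < lam M) (hw : IsPlanarCoordinates M t w)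
    (hs : IsContractingCoordinates M t s) (e : PrimarySpace M) :
    codingMap M t e = proj (expandSum e • w + contractSum e • s) :=
  ((tendsto_sum_nsmul_toralAut hl hw hs e).comp (tendsto_atTop_diagonal (α := ℕ))).limUnder_eq

theorem codingMap_eq_proj_of_hasSum (hl : lam M ≠ 0) (hw : IsPlanarCoordinates M t w)
    {e : PrimarySpace M} {x : ℝ} (hx : HasSum (fun n : ℤ => (e.seq n : ℝ) * lam M ^ (-n)) x) :
    codingMap M t e = proj (x • w) := by
  have hIcc : Tendsto (fun N : ℕ => Finset.Icc (-(N : ℤ)) N) atTop atTop := by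
    refine tendsto_atTop_finset_of_monotone (fun m n h => ?_)
      fun n => ⟨n.natAbs, Finset.mem_Icc.2 (by omega)⟩
    exact Finset.Icc_subset_Icc (by simpa) (by simpa)
  refine Tendsto.limUnder_eq ?_
  simp only [← hw.2, sum_nsmul_toralAut_zpow_proj hl hw.planarAut_eq]
  exact (continuous_proj.tendsto _).comp ((Tendsto.comp hx hIcc).smul_const w)

theorem codingMap_zero (e : PrimarySpace M) : codingMap M 0 e = 0 := by
  have h : ∀ n : ℤ, toralAut (M ^ n) 0 = 0 := fun n => by
    rw [← proj_zero, toralAut_proj, Matrix.mulVec_zero]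
  refine Tendsto.limUnder_eq ?_
  simp only [h, smul_zero, Finset.sum_const_zero, tendsto_const_nhds]

theorem codingMap_single_zero (hl : lam M ≠ 0) (hw : IsPlanarCoordinates M t w) :
    codingMap M t (single M 0) = t := by
  have h := hasSum_ite_eq (0 : ℤ) (1 : ℝ)
  rw [codingMap_eq_proj_of_hasSum hl hw (x := 1), one_smul, hw.2]
  refine h.congr_fun fun n => ?_
  rw [single_seq]
  split_ifs with hn <;> simp [hn]

theorem isEquivariantHom_codingMap (hl : 1 < lam M) (hw : IsPlanarCoordinates M t w)
    (hs : IsContractingCoordinates M t s) : IsEquivariantHom (codingMap M t) where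
  continuous := by
    rw [funext (codingMap_eq hl hw hs)]
    exact continuous_proj.comp ((continuous_expandSum.smul continuous_const).add
      ((continuous_contractSum hl).smul continuous_const))
  map_add e e' := by
    simp only [codingMap_eq hl hw hs, expandSum_add, contractSum_add hl, ← proj_add]
    congr 1
    module
  map_shift e := by
    -- The digit at `0` moves from the expanding to the contracting part of the sum.
    have hT : proj (lam M • w) = proj (lamConj M • s) := by
      rw [← hw.planarAut_eq, ← hs.1, proj_planarAut, proj_planarAut, hw.2, hs.2]
    have hexpand : proj ((lam M * (expandSum e - e.seq 0)) • w) =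
        proj (expandSum e • lam M • w) - e.seq 0 • proj (lam M • w) := by
      rw [← proj_nsmul, ← proj_sub]
      congr 1
      module
    have hcontract : proj ((lamConj M * (e.seq 0 + contractSum e)) • s) =
        e.seq 0 • proj (lamConj M • s) + proj (contractSum e • lamConj M • s) := by
      rw [← proj_nsmul, ← proj_add]
      congr 1
      module
    rw [codingMap_eq hl hw hs, codingMap_eq hl hw hs, ← proj_planarAut, map_add, map_smul,
      map_smul, hw.planarAut_eq, hs.1, proj_add, proj_add,
      expandSum_shift (one_pos.trans hl).ne', contractSum_shift hl, hexpand, hcontract, hT]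
    abel

theorem proj_smul_injective (hirr : Irrational (lam M)) (hw : planarAut M w = lam M • w)
    (hne : w ≠ 0) : Function.Injective fun x : ℝ => proj (x • w) := by
  intro x y hxy
  have hproj : proj ((x - y) • w) = 0 := by rw [sub_smul, proj_sub, sub_eq_zero]; exact hxy
  have h := eq_zero_of_planarAut_eq_lam_smul hirr (by rw [map_smul, hw, smul_comm]) hproj
  exact sub_eq_zero.1 ((smul_eq_zero.1 h).resolve_right hne)

theorem IsPlanarCoordinates.unique (hirr : Irrational (lam M)) {w' : Fin 2 → ℝ}
    (hw : IsPlanarCoordinates M t w) (hw' : IsPlanarCoordinates M t w') : w = w' := by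
  refine sub_eq_zero.1 (eq_zero_of_planarAut_eq_lam_smul hirr ?_ ?_)
  · rw [map_sub, hw.planarAut_eq, hw'.planarAut_eq, smul_sub]
  · rw [proj_sub, hw.2, hw'.2, sub_self]

theorem IsPlanarCoordinates.ne_zero (hw : IsPlanarCoordinates M t w) (ht : t ≠ 0) : w ≠ 0 := by
  rintro rfl
  exact ht (hw.2.symm.trans proj_zero)

theorem injOn_codingMap_admissible {a : ℕ → ℕ} (ha : IsQuasiGreedy (lam M) a)
    (hirr : Irrational (lam M)) (hw : IsPlanarCoordinates M t w) (ht : t ≠ 0) :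
    Set.InjOn (codingMap M t) ({e | Admissible a e.seq} ∩ finiteSeqs M) := by
  rintro e ⟨he, hfin⟩ e' ⟨he', hfin'⟩ heq
  have hsum : ∀ f ∈ finiteSeqs M, Summable fun n : ℤ => (f.seq n : ℝ) * lam M ^ (-n) := fun f hf =>
    summable_of_hasFiniteSupport <| hf.subset fun n hn => by
      simp only [Function.mem_support] at hn ⊢
      exact fun h => hn (by rw [h, Nat.cast_zero, zero_mul])
  have hl := (one_pos.trans ha.one_lt).ne'
  rw [codingMap_eq_proj_of_hasSum hl hw (hsum e hfin).hasSum,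
    codingMap_eq_proj_of_hasSum hl hw (hsum e' hfin').hasSum] at heq
  have hx := proj_smul_injective hirr hw.planarAut_eq (hw.ne_zero ht) heq
  exact PrimarySpace.ext
    (ha.eq_of_hasSum he he' hfin hfin' (hsum e hfin).hasSum (hx ▸ (hsum e' hfin').hasSum))

theorem image_codingMap_admissible {a : ℕ → ℕ} (ha : IsQuasiGreedy (lam M) a)
    (hirr : Irrational (lam M)) (hw : IsPlanarCoordinates M t w)
    (hs : IsContractingCoordinates M t s) (ht : t ≠ 0) :
    codingMap M t '' {e | Admissible a e.seq} = Set.univ := by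
  have hl := ha.one_lt
  have hclosed := ((isCompact_admissible hl a).image
    (isEquivariantHom_codingMap hl hw hs).continuous).isClosed
  obtain ⟨hw0, hslope⟩ := irrational_slope hirr hw.planarAut_eq (hw.ne_zero ht)
  have hdense := dense_proj_smul_image_Ici hw0 hslope
  rw [← hclosed.closure_eq]
  refine (hdense.mono ?_).closure_eq
  rintro _ ⟨x, hx, rfl⟩
  obtain ⟨e, he, hex⟩ := ha.exists_admissible_hasSum hx
  exact ⟨⟨e, mem_primarySubmonoid_of_le hl he.le_zero⟩, he,
    codingMap_eq_proj_of_hasSum (one_pos.trans hl).ne' hw hex⟩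

/-- An equivariant homomorphism as a bundled additive homomorphism. -/
def IsEquivariantHom.toAddMonoidHom {φ : PrimarySpace M → Torus} (hφ : IsEquivariantHom φ) :
    PrimarySpace M →+ Torus := AddMonoidHom.mk' φ hφ.map_add

theorem IsEquivariantHom.map_single_eq {φ : PrimarySpace M → Torus} (hφ : IsEquivariantHom φ)
    (n : ℤ) : φ (single M n) = toralAut M (φ (single M (n + 1))) := by
  rw [← hφ.map_shift, shift_single]

theorem IsEquivariantHom.map_single {φ : PrimarySpace M → Torus} (hφ : IsEquivariantHom φ)
    (n : ℤ) : φ (single M n) = toralAut (M ^ (-n)) (φ (single M 0)) := by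
  induction n using Int.induction_on with
  | zero => simp [toralAut_one]
  | succ n ih =>
    rw [neg_add_rev, toralAut_zpow_add, ← ih, hφ.map_single_eq n, ← toralAut_mul, zpow_neg_one,
      inv_mul_cancel, toralAut_one]
  | pred n ih =>
    rw [hφ.map_single_eq, sub_add_cancel, ih, ← toralAut_mul, ← zpow_one_add]
    congr 2
    ring

theorem IsEquivariantHom.eq_of_single_zero {φ ψ : PrimarySpace M → Torus}
    (hφ : IsEquivariantHom φ) (hψ : IsEquivariantHom ψ)
    (h : φ (single M 0) = ψ (single M 0)) : φ = ψ := by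
  have htrunc : ∀ (χ : PrimarySpace M → Torus), IsEquivariantHom χ → ∀ e k,
      χ (trunc e k) = ∑ n ∈ Finset.Icc (-(k : ℤ)) k,
        e.seq n • toralAut (M ^ (-n)) (χ (single M 0)) := by
    intro χ hχ e k
    simp only [← hχ.map_single]
    exact (map_sum hχ.toAddMonoidHom _ _).trans
      (Finset.sum_congr rfl fun n _ => map_nsmul hχ.toAddMonoidHom _ _)
  funext e
  refine tendsto_nhds_unique ((hφ.continuous.tendsto e).comp (tendsto_trunc e))
    (((hψ.continuous.tendsto e).comp (tendsto_trunc e)).congr fun k => ?_)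
  rw [Function.comp_apply, Function.comp_apply, htrunc φ hφ, htrunc ψ hψ, h]

theorem IsEquivariantHom.isHomoclinic {φ : PrimarySpace M → Torus} (hl : 1 < lam M)
    (hφ : IsEquivariantHom φ) : IsHomoclinic M (φ (single M 0)) := by
  have hlim := (hφ.continuous.tendsto 0).comp
    ((tendsto_single hl).comp neg_injective.tendsto_cofinite)
  rw [show φ 0 = 0 from map_zero hφ.toAddMonoidHom, Int.cofinite_eq, tendsto_sup] at hlim
  have horbit : φ ∘ single M ∘ Neg.neg = fun n => toralAut (M ^ n) (φ (single M 0)) :=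
    funext fun n => by rw [Function.comp_apply, Function.comp_apply, hφ.map_single, neg_neg]
  rw [horbit] at hlim
  exact ⟨hlim.2, hlim.1⟩

theorem bijOn_codingMap (hM : IsHyperbolic M) (hr : 0 < tr M) :
    Set.BijOn (codingMap M) {t | IsHomoclinic M t} {φ | IsEquivariantHom φ} := by
  have hl := hM.one_lt_lam hr
  have hl0 := (one_pos.trans hl).ne'
  have hhom : ∀ t, IsHomoclinic M t →
      IsEquivariantHom (codingMap M t) ∧ codingMap M t (single M 0) = t := fun t ht => by
    obtain ⟨w, hw⟩ := ht.exists_isPlanarCoordinates hM hr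
    obtain ⟨s, hs⟩ := ht.exists_isContractingCoordinates hM hr
    exact ⟨isEquivariantHom_codingMap hl hw hs, codingMap_single_zero hl0 hw⟩
  refine ⟨fun t ht => (hhom t ht).1, fun t ht t' ht' h => ?_, fun φ hφ => ?_⟩
  · rw [← (hhom t ht).2, h, (hhom t' ht').2]
  · have ht := hφ.isHomoclinic hl
    exact ⟨_, ht, (hhom _ ht).1.eq_of_single_zero hφ (hhom _ ht).2⟩

end CodingMap

section CarryRelations

variable {M : GL (Fin 2) ℤ}

theorem toralAut_toralAut (x : Torus) :
    toralAut M (toralAut M x) + dt M • x = tr M • toralAut M x := by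
  funext i
  fin_cases i <;>
  · simp only [toralAut, tr, dt, Matrix.trace_fin_two, Matrix.det_fin_two, Fin.sum_univ_two,
      Pi.add_apply, Pi.smul_apply, Fin.zero_eta, Fin.mk_one]
    module

theorem IsEquivariantHom.map_single_add {φ : PrimarySpace M → Torus} (hφ : IsEquivariantHom φ)
    (n : ℤ) :
    φ (single M (n - 1)) + dt M • φ (single M (n + 1)) = tr M • φ (single M n) := by
  rw [hφ.map_single_eq (n - 1), sub_add_cancel, hφ.map_single_eq n, toralAut_toralAut]

/-- The forbidden word `r 1` of the Markov compactum, as a finite sequence. -/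
noncomputable def markovWord (M : GL (Fin 2) ℤ) (r : ℕ) : PrimarySpace M :=
  r • single M 0 + single M 1

/-- The forbidden word `(r-1)(r-2)^k(r-1)` of the sofic compactum, as a finite sequence, in terms
of `d = r - 2`. -/
noncomputable def soficWord (M : GL (Fin 2) ℤ) (d k : ℕ) : PrimarySpace M :=
  (d + 1) • single M 0 + ∑ i ∈ Finset.range k, d • single M (i + 1) + (d + 1) • single M (k + 1)

theorem seq_nsmul_single (c : ℕ) (n m : ℤ) :
    (c • single M n).seq m = if m = n then c else 0 := by
  have h : (c • single M n).seq = c • (single M n).seq := map_nsmul (seqHom M) c _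
  rw [h, Pi.smul_apply, single_seq, smul_eq_mul, mul_ite, mul_one, mul_zero]

theorem markovWord_seq (r : ℕ) (m : ℤ) :
    (markovWord M r).seq m = if m = 0 then r else if m = 1 then 1 else 0 := by
  rw [markovWord, seq_add, Pi.add_apply, seq_nsmul_single, single_seq]
  split_ifs <;> omega

theorem soficWord_seq (d k : ℕ) (m : ℤ) :
    (soficWord M d k).seq m =
      if m = 0 ∨ m = k + 1 then d + 1 else if 0 < m ∧ m ≤ k then d else 0 := by
  have hmid : (∑ i ∈ Finset.range k, d • single M (i + 1)).seq m =
      if 0 < m ∧ m ≤ k then d else 0 := by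
    induction k with
    | zero => rw [Finset.sum_range_zero, if_neg (by omega), seq_zero, Pi.zero_apply]
    | succ k ih =>
      rw [Finset.sum_range_succ, seq_add, Pi.add_apply, ih, seq_nsmul_single]
      split_ifs <;> omega
  rw [soficWord, seq_add, seq_add, Pi.add_apply, Pi.add_apply, hmid, seq_nsmul_single,
    seq_nsmul_single]
  split_ifs <;> omega

theorem mem_finiteSeqs_of_eq_zero {e : PrimarySpace M} (S : Finset ℤ)
    (h : ∀ n, n ∉ S → e.seq n = 0) : e ∈ finiteSeqs M :=
  S.finite_toSet.subset fun n hn => by_contra fun hS => hn (h n hS)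

theorem single_mem_finiteSeqs (n : ℤ) : single M n ∈ finiteSeqs M :=
  mem_finiteSeqs_of_eq_zero {n} fun m hm => by
    rw [single_seq, if_neg (by simpa using hm)]

theorem single_add_single_mem_finiteSeqs (n n' : ℤ) : single M n + single M n' ∈ finiteSeqs M :=
  ((single_mem_finiteSeqs n).union (single_mem_finiteSeqs n')).subset (Function.support_add _ _)

theorem markovWord_mem_finiteSeqs (r : ℕ) : markovWord M r ∈ finiteSeqs M :=
  mem_finiteSeqs_of_eq_zero {0, 1} fun m hm => by
    simp only [Finset.mem_insert, Finset.mem_singleton, not_or] at hm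
    rw [markovWord_seq, if_neg hm.1, if_neg hm.2]

theorem soficWord_mem_finiteSeqs (d k : ℕ) : soficWord M d k ∈ finiteSeqs M :=
  mem_finiteSeqs_of_eq_zero (Finset.Icc 0 (k + 1)) fun m hm => by
    rw [Finset.mem_Icc] at hm
    rw [soficWord_seq, if_neg (by omega), if_neg (by omega)]

theorem IsEquivariantHom.map_markovWord {φ : PrimarySpace M → Torus} (hφ : IsEquivariantHom φ)
    (hd : dt M = -1) {r : ℕ} (hr : (r : ℤ) = tr M) :
    φ (markovWord M r) = φ (single M (-1)) := by
  have hcarry := hφ.map_single_add 0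
  rw [hd, ← hr, natCast_zsmul, neg_one_zsmul, ← sub_eq_add_neg, sub_eq_iff_eq_add] at hcarry
  rw [markovWord, hφ.map_add]
  exact (congrArg (· + _) (map_nsmul hφ.toAddMonoidHom r _)).trans hcarry.symm

-- The relation at the positions `0, …, k + 1`, summed up.
theorem sum_carry {G : Type*} [AddCommGroup G] {u : ℤ → G} {d : ℕ}
    (hu : ∀ n, u (n - 1) + u (n + 1) = (d + 2) • u n) (k : ℕ) :
    (d + 1) • u 0 + ∑ i ∈ Finset.range k, d • u (i + 1) + (d + 1) • u (k + 1) =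
      u (-1) + u (k + 2) := by
  induction k with
  | zero =>
    have h0 := hu 0
    have h1 := hu 1
    norm_num at h0 h1 ⊢
    have h : u (-1) + u 2 = (u (-1) + u 1) + (u 0 + u 2) - u 0 - u 1 := by abel
    rw [h, h0, h1]
    module
  | succ k ih =>
    have hnext := hu (k + 2)
    rw [show (k : ℤ) + 2 - 1 = k + 1 by ring, show (k : ℤ) + 2 + 1 = k + 3 by ring] at hnext
    rw [Finset.sum_range_succ]
    push_cast
    rw [show (k : ℤ) + 1 + 1 = k + 2 by ring, show (k : ℤ) + 1 + 2 = k + 3 by ring,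
      ← add_left_inj (u (k + 1)), add_assoc (u (-1)), add_comm (u (k + 3)), hnext,
      ← sub_eq_zero]
    have hih := sub_eq_zero.2 ih
    rw [← hih]
    module

theorem IsEquivariantHom.map_soficWord {φ : PrimarySpace M → Torus} (hφ : IsEquivariantHom φ)
    (hd : dt M = 1) {d : ℕ} (hr : (d : ℤ) + 2 = tr M) (k : ℕ) :
    φ (soficWord M d k) = φ (single M (-1) + single M (k + 2)) := by
  have hcarry : ∀ n, φ (single M (n - 1)) + φ (single M (n + 1)) = (d + 2) • φ (single M n) :=
    fun n => by
      have h := hφ.map_single_add n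
      rw [hd, one_zsmul, ← hr] at h
      exact_mod_cast h
  rw [hφ.map_add]
  refine Eq.trans ?_ (sum_carry (u := fun n => φ (single M n)) hcarry k)
  have hsum := map_sum hφ.toAddMonoidHom (fun i : ℕ => d • single M (i + 1)) (Finset.range k)
  have hsmul : ∀ (c : ℕ) e, φ (c • e) = c • φ e := map_nsmul hφ.toAddMonoidHom
  change φ _ = ∑ _ ∈ _, φ _ at hsum
  simp only [soficWord, hφ.map_add, hsum, hsmul]

theorem admissible_tail_markovWord {r : ℕ} (hr : 0 < r) :
    Admissible (tail (markovWord M r).seq 0) (markovWord M r).seq := by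
  intro m
  refine lexLE_iff.2 fun j hj => ?_
  have h0 := hj 0
  have h1 := hj 1
  simp only [tail, markovWord_seq] at h0 h1 ⊢
  push_cast at h0 h1
  split_ifs at h0 h1 ⊢ <;> omega

theorem admissible_tail_markovWord_single {r : ℕ} (hr : 0 < r) (n : ℤ) :
    Admissible (tail (markovWord M r).seq 0) (single M n).seq := by
  intro m
  refine lexLE_iff.2 fun j hj => ?_
  have h0 := hj 0
  simp only [tail, markovWord_seq, single_seq] at h0 ⊢
  split_ifs at h0 ⊢ <;> omega

theorem admissible_tail_soficWord (d k : ℕ) :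
    Admissible (tail (soficWord M d k).seq 0) (soficWord M d k).seq := by
  intro m
  refine lexLE_iff.2 fun j hj => ?_
  simp only [tail, soficWord_seq] at hj ⊢
  obtain rfl | hj0 := j.eq_zero_or_pos
  · split_ifs <;> omega
  · have h0 := hj 0 hj0
    split_ifs at h0 ⊢ <;> omega

theorem admissible_tail_soficWord_single_add_single {d : ℕ} (hd : 0 < d) (k : ℕ) (n n' : ℤ) :
    Admissible (tail (soficWord M d k).seq 0) (single M n + single M n').seq := by
  intro m
  refine lexLE_iff.2 fun j hj => ?_
  have h0 := hj 0
  simp only [tail, soficWord_seq, seq_add, Pi.add_apply, single_seq] at h0 ⊢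
  split_ifs at h0 ⊢ <;> omega

-- By totality both codes of the common image would lie in `X`.
theorem IsArithmeticCoding.not_lexLE {φ : PrimarySpace M → Torus} {X : Set (PrimarySpace M)}
    (hX : IsArithmeticCoding φ X) {f g : PrimarySpace M} (hf : f ∈ finiteSeqs M)
    (hg : g ∈ finiteSeqs M) (hfg : φ f = φ g) (hne : f ≠ g)
    (hf' : Admissible (tail f.seq 0) f.seq) (hg' : Admissible (tail f.seq 0) g.seq)
    {e : PrimarySpace M} (he : e ∈ X) (n : ℤ) : ¬ LexLE (tail f.seq 0) (tail e.seq n) :=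
  fun h => hne <| hX.injective_on_finite
    ⟨hX.total e he f ⟨n, fun _ => (hf' _).trans h⟩, hf⟩
    ⟨hX.total e he g ⟨n, fun _ => (hg' _).trans h⟩, hg⟩ hfg

theorem IsArithmeticCoding.seq_mem_markovCompactum {φ : PrimarySpace M → Torus}
    {X : Set (PrimarySpace M)} (hX : IsArithmeticCoding φ X) (hd : dt M = -1) (hr : 0 < tr M)
    {e : PrimarySpace M} (he : e ∈ X) : e.seq ∈ markovCompactum (tr M) := by
  lift tr M to ℕ using hr.le with r hrr
  have hne : markovWord M r ≠ single M (-1) := fun h => by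
    have h0 := congrFun (congrArg PrimarySpace.seq h) (-1)
    simp [markovWord_seq, single_seq] at h0
  have hnot := hX.not_lexLE (markovWord_mem_finiteSeqs r) (single_mem_finiteSeqs (-1))
    (hX.hom.map_markovWord hd hrr) hne (admissible_tail_markovWord (by omega))
    (admissible_tail_markovWord_single (by omega) _) he
  intro n
  by_contra hn
  refine hnot n (lexLE_iff.2 fun j hj => ?_)
  have h0 := hj 0
  simp only [tail, markovWord_seq, Nat.cast_zero, add_zero, if_true] at h0 ⊢
  obtain rfl | rfl | hj2 : j = 0 ∨ j = 1 ∨ 2 ≤ j := by omega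
  · simp only [Nat.cast_zero, add_zero, if_true]
    omega
  · simp only [Nat.cast_one, zero_add, one_ne_zero, if_false, if_true]
    omega
  · rw [if_neg (by omega), if_neg (by omega)]
    exact Nat.zero_le _

theorem IsArithmeticCoding.seq_mem_soficCompactum {φ : PrimarySpace M → Torus}
    {X : Set (PrimarySpace M)} (hX : IsArithmeticCoding φ X) (hd : dt M = 1) (hr : 3 ≤ tr M)
    {e : PrimarySpace M} (he : e ∈ X) : e.seq ∈ soficCompactum (tr M) := by
  obtain ⟨d, hdr⟩ : ∃ d : ℕ, (d : ℤ) + 2 = tr M := ⟨(tr M - 2).toNat, by omega⟩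
  have hne : ∀ k : ℕ, soficWord M d k ≠ single M (-1) + single M (k + 2) := fun k h => by
    have h0 := congrFun (congrArg PrimarySpace.seq h) (-1)
    simp only [soficWord_seq, seq_add, Pi.add_apply, single_seq] at h0
    split_ifs at h0 <;> omega
  have hnot := fun k => hX.not_lexLE (soficWord_mem_finiteSeqs d k)
    (single_add_single_mem_finiteSeqs (-1) (k + 2)) (hX.hom.map_soficWord hd hdr k) (hne k)
    (admissible_tail_soficWord d k)
    (admissible_tail_soficWord_single_add_single (by omega) k _ _) he
  refine fun n => ⟨?_, fun s ⟨_, hmid, _⟩ => ?_⟩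
  · by_contra hn
    refine hnot 0 n (lexLE_iff.2 fun j hj => ?_)
    have h0 := hj 0
    simp only [tail, soficWord_seq, Nat.cast_zero, add_zero, true_or, if_true] at h0 ⊢
    obtain rfl | hj0 := j.eq_zero_or_pos
    · simp only [Nat.cast_zero, add_zero, true_or, if_true]
      omega
    · have := h0 hj0
      omega
  · refine hnot s n (lexLE_iff.2 fun j _ => ?_)
    simp only [tail, soficWord_seq]
    obtain rfl | hjs | rfl | hjs : j = 0 ∨ (1 ≤ j ∧ j ≤ s) ∨ j = s + 1 ∨ s + 2 ≤ j := by omega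
    · rw [if_pos (by simp), Nat.cast_zero, add_zero]
      omega
    · rw [if_neg (by omega), if_pos (by omega)]
      have := hmid j hjs.1 hjs.2
      omega
    · rw [if_pos (by omega), Nat.cast_succ, ← add_assoc]
      omega
    · rw [if_neg (by omega), if_neg (by omega)]
      exact Nat.zero_le _

theorem IsArithmeticCoding.subset_compactum {φ : PrimarySpace M → Torus}
    {X : Set (PrimarySpace M)} (hX : IsArithmeticCoding φ X) (hM : IsHyperbolic M)
    (hr : 0 < tr M) : X ⊆ {e | e.seq ∈ compactum M} := by
  intro e he
  rw [Set.mem_ofPred_eq, compactum]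
  split_ifs with hd
  · exact hX.seq_mem_markovCompactum hd hr he
  · have hd' := (dt_eq_one_or M).resolve_right hd
    exact hX.seq_mem_soficCompactum hd' (hM.three_le_tr hr hd') he

end CarryRelations

section Classification

variable {M : GL (Fin 2) ℤ} {t : Torus} {w s : Fin 2 → ℝ} {X : Set (PrimarySpace M)}

theorem exists_dual_eq_one_eq_zero {K V : Type*} [Field K] [AddCommGroup V] [Module K V]
    {A : V →ₗ[K] V} {μ ν : K} {v v' : V} (hμν : μ ≠ ν) (hv : A v = μ • v) (hv' : A v' = ν • v')
    (hne : v ≠ 0) : ∃ ℓ : Module.Dual K V, ℓ v = 1 ∧ ℓ v' = 0 := by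
  obtain ⟨g, hg⟩ : ∃ g : Module.Dual K V, g v ≠ 0 := by
    by_contra! h
    exact hne ((Module.forall_dual_apply_eq_zero_iff K v).1 h)
  refine ⟨((μ - ν) * g v)⁻¹ • g ∘ₗ (A - ν • LinearMap.id), ?_, ?_⟩
  · simp only [LinearMap.smul_apply, LinearMap.comp_apply, LinearMap.sub_apply, hv,
      LinearMap.id_apply, ← sub_smul, map_smul, smul_eq_mul]
    exact inv_mul_cancel₀ (mul_ne_zero (sub_ne_zero.2 hμν) hg)
  · simp only [LinearMap.smul_apply, LinearMap.comp_apply, LinearMap.sub_apply, hv',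
      LinearMap.id_apply, sub_self, map_zero, smul_zero]

theorem lam_ne_lamConj (hl : 1 < lam M) : lam M ≠ lamConj M := fun h => by
  have habs := abs_lamConj hl
  rw [← h, abs_of_pos (one_pos.trans hl)] at habs
  linarith [inv_lt_one_of_one_lt₀ hl]

theorem exists_expandSum_add_eq (hl : 1 < lam M) (hw : IsPlanarCoordinates M t w)
    (hs : IsContractingCoordinates M t s) (ht : t ≠ 0)
    (hX : codingMap M t '' X = Set.univ) :
    ∃ c : (Fin 2 → ℤ) → ℝ, ∀ x : ℝ, ∃ e ∈ X, ∃ z, x = c z + expandSum e := by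
  obtain ⟨ℓ, hℓw, hℓs⟩ := exists_dual_eq_one_eq_zero (lam_ne_lamConj hl) hw.planarAut_eq hs.1
    (hw.ne_zero ht)
  refine ⟨fun z => ℓ fun i => (z i : ℝ), fun x => ?_⟩
  obtain ⟨e, he, hex⟩ := hX.ge (Set.mem_univ (proj (x • w)))
  rw [codingMap_eq hl hw hs] at hex
  have hdiff : proj (x • w - (expandSum e • w + contractSum e • s)) = 0 := by
    rw [proj_sub, hex, sub_self]
  choose z hz using exists_int_of_proj_eq_zero hdiff
  have hℓ := congrArg ℓ (funext hz)
  simp only [map_sub, map_add, map_smul, hℓw, hℓs, smul_eq_mul, mul_one, mul_zero, add_zero] at hℓ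
  exact ⟨e, he, z, eq_add_of_sub_eq hℓ.symm⟩

-- Otherwise `ℝ` would be covered by countably many translates of a null set.
theorem exists_matching {a : ℕ → ℕ} (ha : IsQuasiGreedy (lam M) a)
    (hw : IsPlanarCoordinates M t w) (hs : IsContractingCoordinates M t s) (ht : t ≠ 0)
    (hXa : X ⊆ {e | Admissible a e.seq}) (hX : codingMap M t '' X = Set.univ) (m : ℕ) :
    ∃ e ∈ X, ∃ n : ℤ, ∀ i < m, tail e.seq n i = a i := by
  by_contra! hdiffer
  have hdrops : ∀ e ∈ X, e.seq ∈ dropsWithin a m := by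
    intro e he n
    obtain ⟨i, him, hi⟩ := hdiffer e he n
    obtain ⟨j, hji, hj⟩ := (hXa he n).exists_lt hi
    exact ⟨j, hji.trans_lt him, hj⟩
  obtain ⟨c, hc⟩ := exists_expandSum_add_eq ha.one_lt hw hs ht hX
  set E := (fun e => digitSum (lam M) (tail e 0)) '' dropsWithin a m
  have hcover : (Set.univ : Set ℝ) ⊆ ⋃ z, c z +ᵥ lam M • E := by
    rintro x -
    obtain ⟨e, he, z, rfl⟩ := hc x
    rw [expandSum_eq_mul_digitSum (one_pos.trans ha.one_lt).ne']
    exact Set.mem_iUnion.2 ⟨z, Set.vadd_mem_vadd_set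
      (Set.smul_mem_smul_set (Set.mem_image_of_mem _ (hdrops e he)))⟩
  have hnull : volume (⋃ z, c z +ᵥ lam M • E) = 0 := measure_iUnion_null fun z => by
    rw [measure_vadd, Measure.addHaar_smul, ha.volume_digitSum_tail_image_dropsWithin m, mul_zero]
  exact (measure_mono_null hcover hnull).not_gt (by simp)

theorem IsArithmeticCoding.exists_isHomoclinic {φ : PrimarySpace M → Torus}
    (hX : IsArithmeticCoding φ X) (hM : IsHyperbolic M) (hr : 0 < tr M) :
    ∃ t, (IsHomoclinic M t ∧ t ≠ 0) ∧ codingMap M t = φ ∧ X = {e | e.seq ∈ compactum M} := by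
  obtain ⟨t, ht, rfl⟩ := (bijOn_codingMap hM hr).surjOn hX.hom
  have ht0 : t ≠ 0 := by
    rintro rfl
    obtain ⟨e, -, he⟩ := hX.surjective.ge (Set.mem_univ (proj fun _ => 1 / 2))
    rw [codingMap_zero] at he
    have h := congrFun (eq_zero_of_proj_eq_zero he.symm
      ((pi_norm_lt_iff one_pos).2 fun _ => by norm_num [abs_lt])) 0
    norm_num at h
  refine ⟨t, ⟨ht, ht0⟩, rfl, (hX.subset_compactum hM hr).antisymm ?_⟩
  obtain ⟨w, hw⟩ := ht.exists_isPlanarCoordinates hM hr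
  obtain ⟨s, hs⟩ := ht.exists_isContractingCoordinates hM hr
  have hXa := hX.subset_compactum hM hr
  rw [setOf_mem_compactum_eq hM hr] at hXa ⊢
  have ha := isQuasiGreedy_critSeq hM hr
  exact admissible_subset_of_matching ha hX.closed hX.total
    (exists_matching ha hw hs ht0 hXa hX.surjective)

theorem IsHomoclinic.isArithmeticCoding (ht : IsHomoclinic M t) (hM : IsHyperbolic M)
    (hr : 0 < tr M) (ht0 : t ≠ 0) :
    IsArithmeticCoding (codingMap M t) {e | e.seq ∈ compactum M} := by
  obtain ⟨w, hw⟩ := ht.exists_isPlanarCoordinates hM hr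
  obtain ⟨s, hs⟩ := ht.exists_isContractingCoordinates hM hr
  have hl := hM.one_lt_lam hr
  have ha := isQuasiGreedy_critSeq hM hr
  have hirr := hM.irrational_lam hr
  rw [setOf_mem_compactum_eq hM hr]
  exact {
    hom := isEquivariantHom_codingMap hl hw hs
    closed := (isClosed_admissible _).preimage continuous_seq
    shift_invariant := shift_image_admissible hl _
    total := isTotal_admissible _
    surjective := image_codingMap_admissible ha hirr hw hs ht0
    injective_on_finite := injOn_codingMap_admissible ha hirr hw ht0 }

theorem IsHomoclinic.existsUnique_isPlanarCoordinates (ht : IsHomoclinic M t)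
    (hM : IsHyperbolic M) (hr : 0 < tr M) : ∃! w, IsPlanarCoordinates M t w := by
  obtain ⟨w, hw⟩ := ht.exists_isPlanarCoordinates hM hr
  exact ⟨w, hw, fun _ hw' => hw'.unique (hM.irrational_lam hr) hw⟩

theorem IsHomoclinic.tendsto_codingMap (ht : IsHomoclinic M t) (hM : IsHyperbolic M)
    (hr : 0 < tr M) (e : PrimarySpace M) :
    Tendsto (fun p : ℕ × ℕ => ∑ n ∈ Finset.Icc (-(p.1 : ℤ)) (p.2 : ℤ),
      e.seq n • toralAut (M ^ (-n)) t) atTop (𝓝 (codingMap M t e)) := by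
  obtain ⟨w, hw⟩ := ht.exists_isPlanarCoordinates hM hr
  obtain ⟨s, hs⟩ := ht.exists_isContractingCoordinates hM hr
  rw [codingMap_eq (hM.one_lt_lam hr) hw hs]
  exact tendsto_sum_nsmul_toralAut (hM.one_lt_lam hr) hw hs e

theorem IsHomoclinic.tendsto_proj_smul (ht : IsHomoclinic M t) (hM : IsHyperbolic M)
    (hr : 0 < tr M) (hw : IsPlanarCoordinates M t w) (e : PrimarySpace M) :
    Tendsto (fun p : ℕ × ℕ => proj
      ((∑ n ∈ Finset.Icc (-(p.1 : ℤ)) (p.2 : ℤ), (e.seq n : ℝ) * lam M ^ (-n)) • w))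
      atTop (𝓝 (codingMap M t e)) := by
  have hl := (one_pos.trans (hM.one_lt_lam hr)).ne'
  simp only [← sum_nsmul_toralAut_zpow_proj hl hw.planarAut_eq, hw.2]
  exact ht.tendsto_codingMap hM hr e

theorem IsHomoclinic.surjective_codingMap (ht : IsHomoclinic M t) (hM : IsHyperbolic M)
    (hr : 0 < tr M) (ht0 : t ≠ 0) : Function.Surjective (codingMap M t) :=
  Set.range_eq_univ.1 <| Set.univ_subset_iff.1 <|
    (ht.isArithmeticCoding hM hr ht0).surjective.ge.trans (Set.image_subset_range _ _)

theorem bijOn_codingMap_compactum (hM : IsHyperbolic M) (hr : 0 < tr M) :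
    Set.BijOn (fun t : Torus => (codingMap M t, {e : PrimarySpace M | e.seq ∈ compactum M}))
      {t | IsHomoclinic M t ∧ t ≠ 0} {c | IsArithmeticCoding c.1 c.2} := by
  refine ⟨fun t ht => ht.1.isArithmeticCoding hM hr ht.2, fun t ht t' ht' h => ?_, fun c hc => ?_⟩
  · exact (bijOn_codingMap hM hr).injOn ht.1 ht'.1 (congrArg Prod.fst h)
  · obtain ⟨t, ht, hφ, hX⟩ := IsArithmeticCoding.exists_isHomoclinic hc hM hr
    exact ⟨t, ht, Prod.ext hφ hX.symm⟩

theorem IsArithmeticCoding.seq_image {φ : PrimarySpace M → Torus}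
    (hX : IsArithmeticCoding φ X) (hM : IsHyperbolic M) (hr : 0 < tr M) :
    PrimarySpace.seq '' X = compactum M := by
  obtain ⟨-, -, -, rfl⟩ := hX.exists_isHomoclinic hM hr
  exact seq_image_compactum hM hr

end Classification

end ToralCoding

theorem theorem1p2 (M : GL (Fin 2) ℤ) (hM : ToralCoding.IsHyperbolic M)
    (hr : 0 < ToralCoding.tr M) :
    -- (I) `t ↦ φ_t` is a bijection from the homoclinic points onto the continuous semigroup
    -- homomorphisms that turn the shift into `T`
    Set.BijOn (ToralCoding.codingMap M) {t | ToralCoding.IsHomoclinic M t}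
      {φ | ToralCoding.IsEquivariantHom φ} ∧
    -- both series in the formula for `φ_t` converge, with sum `φ_t(ε)`
    (∀ t : ToralCoding.Torus, ToralCoding.IsHomoclinic M t →
      (∃! w : Fin 2 → ℝ, ToralCoding.IsPlanarCoordinates M t w) ∧
      ∀ e : ToralCoding.PrimarySpace M,
        Filter.Tendsto (fun p : ℕ × ℕ => ∑ n ∈ Finset.Icc (-(p.1 : ℤ)) (p.2 : ℤ),
            e.seq n • ToralCoding.toralAut (M ^ (-n)) t)
          Filter.atTop (nhds (ToralCoding.codingMap M t e)) ∧
        ∀ w : Fin 2 → ℝ, ToralCoding.IsPlanarCoordinates M t w →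
          Filter.Tendsto (fun p : ℕ × ℕ => ToralCoding.proj
              ((∑ n ∈ Finset.Icc (-(p.1 : ℤ)) (p.2 : ℤ),
                (e.seq n : ℝ) * ToralCoding.lam M ^ (-n)) • w))
            Filter.atTop (nhds (ToralCoding.codingMap M t e))) ∧
    -- `φ_t` is surjective for `t ≠ 0`
    (∀ t : ToralCoding.Torus, ToralCoding.IsHomoclinic M t → t ≠ 0 →
      Function.Surjective (ToralCoding.codingMap M t)) ∧
    -- the arithmetic codings `(φ, X)` correspond bijectively to the nonzero homoclinic points
    Set.BijOn (fun t : ToralCoding.Torus =>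
        (ToralCoding.codingMap M t,
          {e : ToralCoding.PrimarySpace M | e.seq ∈ ToralCoding.compactum M}))
      {t | ToralCoding.IsHomoclinic M t ∧ t ≠ 0}
      {c | ToralCoding.IsArithmeticCoding c.1 c.2} ∧
    -- (II) in every coding `X` is the Markov compactum or the sofic compactum
    (∀ (φ : ToralCoding.PrimarySpace M → ToralCoding.Torus)
      (X : Set (ToralCoding.PrimarySpace M)), ToralCoding.IsArithmeticCoding φ X →
      (ToralCoding.dt M = -1 →
        ToralCoding.PrimarySpace.seq '' X = ToralCoding.markovCompactum (ToralCoding.tr M)) ∧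
      (ToralCoding.dt M = 1 →
        ToralCoding.PrimarySpace.seq '' X = ToralCoding.soficCompactum (ToralCoding.tr M))) := by
  refine ⟨ToralCoding.bijOn_codingMap hM hr, fun t ht => ?_, fun t ht ht0 => ?_,
    ToralCoding.bijOn_codingMap_compactum hM hr, fun φ X hX => ?_⟩
  · exact ⟨ht.existsUnique_isPlanarCoordinates hM hr, fun e =>
      ⟨ht.tendsto_codingMap hM hr e, fun w hw => ht.tendsto_proj_smul hM hr hw e⟩⟩
  · exact ht.surjective_codingMap hM hr ht0
  · rw [hX.seq_image hM hr, ToralCoding.compactum]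
    exact ⟨fun hd => if_pos hd, fun hd => if_neg (by omega)⟩
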